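/- Write $e(t)=e^{2\pi i t}$ and let $\|x\|_{\mathbb T}$ be the distance from $x\in\mathbb R$ to the nearest integer. Let $D,d\ge 0$ be integers. For $\vec R=(R_1,\dots,R_D)$ with real $R_i\ge 1$, put $|\vec R|=\prod_i R_i$ and $\vec R^{\alpha}=\prod_i R_i^{\alpha_i}$ for multi-indices $\alpha$. For a real polynomial $P(x)=\sum_\alpha\lambda_\alpha x^\alpha$ in $D$ variables, let $s_0\in\mathbb Z\cup\{-\infty\}$ be the least integer $s$ (with $s_0=-\infty$ if there is no least one) such that either $s\ge 1$ and there is an integer $1\le Q\le 2^s$ with $\sum_\alpha\|Q\lambda_\alpha\|_{\mathbb T}\,\vec R^{\alpha}\le 2^s$, or $s\le 0$ and $\sum_\alpha\|\lambda_\alpha\|_{\mathbb T}\,\vec R^{\alpha}\le 2^s$; the sums include $\alpha=0$. The coefficient norm of $P$ at scale $\vec R$ is $N_{\vec R}(P):=2^{s_0}$ (so it is $0$ when all coefficients are integers). **Theorem.** There are constants $\theta=\theta_{d,D}>0$ and $C=C_{d,D}>0$ such that the following holds for all such $\vec R$, all real polynomials $P$ in $D$ variables of total degree at most $d$, all products $\mathcal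 P=\mathcal P_1\times\dots\times\mathcal P_D$ of finite arithmetic progressions of integers $\mathcal P_i\subset[-R_i,R_i]$, all $\phi:\mathbb Z^D\to\mathbb C$ with $$\|\phi\|_{\ell^\infty}+\sum_{j=1}^D R_j\,\|\phi-\phi(\cdot-e_j)\|_{\ell^\infty}\le 1 ,$$ and all integers $k$. (1) If $k\neq 0$ and $N_{\vec R}(P)=2^s\ge 2$, then $$\Big|\frac1{|\vec R|}\sum_{n\in\mathcal P}e(k\,P(n))\,\phi(n)\Big|\le C\Big(\Big(\frac{|k|}{2^s}\Big)^{\theta}+\sum_{i=1}^D R_i^{-\theta}\Big).$$ (2) If $N_{\vec R}(kP)\le 1$, then $$\Big|\frac1{|\vec R|}\sum_{n\in\mathcal P}e(k\,P(n))\,\phi(n)-\frac1{|\vec R|}\sum_{n\in\mathcal P}\phi(n)\Big|\le C\,N_{\vec R}(kP).$$ -/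

import Mathlib

/-- The complex exponential `e(t) = exp(2πit)`. -/
noncomputable def expE (t : ℝ) : ℂ :=
  Complex.exp (2 * (Real.pi : ℂ) * Complex.I * (t : ℂ))

/-- The weighted sum `∑_α ‖Q λ_α‖_𝕋 R^α` over all multi-indices `α` (the constant term included),
where `P = ∑_α λ_α x^α`, `R^α = ∏_i R_i ^ α_i` and `‖x‖_𝕋` is the distance of `x` to the nearest
integer. -/
noncomputable def torusCoeffSum {D : ℕ} (R : Fin D → ℝ) (Q : ℕ) (P : MvPolynomial (Fin D) ℝ) : ℝ :=
  ∑ α ∈ P.support, ‖(((Q : ℝ) * P.coeff α : ℝ) : UnitAddCircle)‖ * ∏ i, R i ^ α i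

/-- The condition on the integer exponent `s` in the definition of the coefficient norm. -/
def CoeffNormCond {D : ℕ} (R : Fin D → ℝ) (P : MvPolynomial (Fin D) ℝ) (s : ℤ) : Prop :=
  (1 ≤ s ∧ ∃ Q : ℕ, 1 ≤ Q ∧ (Q : ℝ) ≤ (2 : ℝ) ^ s ∧ torusCoeffSum R Q P ≤ (2 : ℝ) ^ s) ∨
    (s ≤ 0 ∧ torusCoeffSum R 1 P ≤ (2 : ℝ) ^ s)

/-- The arithmetic coefficient norm `N_R(P) = 2 ^ s₀`, where `s₀` is the least integer `s` that
satisfies `CoeffNormCond R P s`. If every integer `s ≤ 0` satisfies it, that is, if all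
coefficients of `P` are integers, then `s₀ = -∞` and the value is `0`. -/
noncomputable def coeffNorm {D : ℕ} (R : Fin D → ℝ) (P : MvPolynomial (Fin D) ℝ) : ℝ :=
  sInf {x : ℝ | ∃ s : ℤ, CoeffNormCond R P s ∧ x = (2 : ℝ) ^ s}

/-- A finite (possibly empty) arithmetic progression of integers. -/
def IsArithProg (S : Finset ℤ) : Prop :=
  ∃ (a q : ℤ) (L : ℕ), 0 < q ∧ S = (Finset.range L).image fun j : ℕ => a + q * (j : ℤ)

/-- `A 1 × ⋯ × A D` is a multidimensional arithmetic progression inside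
`[R] = [-R 1, R 1] × ⋯ × [-R D, R D]`. -/
def IsMultiArithProgIn {D : ℕ} (R : Fin D → ℝ) (A : Fin D → Finset ℤ) : Prop :=
  ∀ i, IsArithProg (A i) ∧ ∀ m ∈ A i, |(m : ℝ)| ≤ R i

/-- `‖φ‖_∞ + ∑_j R_j ‖φ - φ(· - e_j)‖_∞`, with values in `[0, ∞]`. -/
noncomputable def amplitudeNorm {D : ℕ} (R : Fin D → ℝ) (φ : (Fin D → ℤ) → ℂ) : ENNReal :=
  (⨆ n, ‖φ n‖ₑ) + ∑ j, ENNReal.ofReal (R j) * ⨆ n, ‖φ n - φ (n - Pi.single j 1)‖ₑ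

/-- The normalized sum `(1 / |R|) ∑_{n ∈ A 1 × ⋯ × A D} f n`, where `|R| = ∏_i R_i`. -/
noncomputable def boxAverage {D : ℕ} (R : Fin D → ℝ) (A : Fin D → Finset ℤ)
    (f : (Fin D → ℤ) → ℂ) : ℂ :=
  ((∏ i, R i : ℝ) : ℂ)⁻¹ * ∑ n ∈ Fintype.piFinset A, f n

/-- The value `P(n)` of a real polynomial at an integer point. -/
noncomputable def evalInt {D : ℕ} (P : MvPolynomial (Fin D) ℝ) (n : Fin D → ℤ) : ℝ :=
  MvPolynomial.eval (fun i => (n i : ℝ)) P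

/-! The first bound is the contrapositive of an inverse theorem, `exists_denominator_of_large_sum`.
Suppose the exponential sum of a polynomial over a product of progressions is at least |R|/K and
every R_i exceeds a fixed power of K. Then a single Q ≤ K^C brings Q times each nonconstant
coefficient within K^C R^{-α} of an integer. Every loss is a power of K, with K ≥ 2 absorbing
numerical constants, and this is what gives a power saving.

Coefficients of top degree are reached by Weyl differencing. Differencing α_j times in each
direction e_j leaves the constant α! c_α h₁h₂⋯. By Cauchy–Schwarz (`card_large_differences`) the sum
stays large for many shifts at each stage. A linear phase is a geometric series, so its denominator
may be taken to be the step of the progression, which is bounded because the box is dense. On the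
way back, `exists_torusNorm_le_of_card` removes one factor h at a time: if γh is near an integer for
many h, then γ is near a rational with small denominator.

Lower degrees follow by induction. With a common denominator M for the top part, that part is almost
constant on residue classes modulo M inside short cells, so `exists_subbox` passes to a piece where
the phase has smaller degree. The pieces are again products of progressions, which is why
progressions are carried throughout. The Lipschitz amplitude is removed in the same way with M = 1.

Applied to kP, this bounds the coefficient norm of P by |k| times a power of K; the terms R_i^{-θ}
cover boxes with a side too short for the inverse theorem. The second bound is pointwise, from |e(x)
- 1| ≤ 2π‖x‖. -/

/-! ### The exponential and the distance to the nearest integer -/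

theorem expE_add (x y : ℝ) : expE (x + y) = expE x * expE y := by
  unfold expE
  rw [← Complex.exp_add]
  push_cast
  ring_nf

theorem expE_intCast (m : ℤ) : expE m = 1 := by
  unfold expE
  rw [← Complex.exp_int_mul_two_pi_mul_I m]
  push_cast
  ring_nf

theorem expE_eq_exp_I (x : ℝ) : expE x = Complex.exp (Complex.I * ((2 * Real.pi * x : ℝ) : ℂ)) := by
  unfold expE
  push_cast
  ring_nf

theorem norm_expE (x : ℝ) : ‖expE x‖ = 1 := by
  rw [expE_eq_exp_I, mul_comm, Complex.norm_exp_ofReal_mul_I]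

theorem expE_mul_conj (x y : ℝ) : expE x * (starRingEnd ℂ) (expE y) = expE (x - y) := by
  have h : (starRingEnd ℂ) (expE y) = expE (-y) := by
    unfold expE
    rw [← Complex.exp_conj]
    simp [map_ofNat]
  rw [h, ← expE_add, sub_eq_add_neg]

theorem expE_sub_intCast (x : ℝ) (m : ℤ) : expE (x - m) = expE x := by
  have := expE_add (x - m) m
  rw [expE_intCast, mul_one, sub_add_cancel] at this
  exact this.symm

theorem norm_expE_sub_one_eq (x : ℝ) : ‖expE x - 1‖ = 2 * |Real.sin (Real.pi * x)| := by
  rw [expE_eq_exp_I, Complex.norm_exp_I_mul_ofReal_sub_one, Real.norm_eq_abs, abs_mul,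
    abs_of_pos (by norm_num : (0 : ℝ) < 2)]
  ring_nf

theorem torusNorm_le_abs_sub (x : ℝ) (m : ℤ) : ‖(x : UnitAddCircle)‖ ≤ |x - m| := by
  rw [UnitAddCircle.norm_eq]
  exact round_le x m

theorem torusNorm_le_half (x : ℝ) : ‖(x : UnitAddCircle)‖ ≤ 1 / 2 := by
  rw [UnitAddCircle.norm_eq]
  exact abs_sub_round x

theorem torusNorm_of_abs_le_half {x : ℝ} (hx : |x| ≤ 1 / 2) : ‖(x : UnitAddCircle)‖ = |x| := by
  exact (AddCircle.norm_coe_eq_abs_iff (p := (1 : ℝ)) (x := x) one_ne_zero).2 (by simpa using hx)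

theorem torusNorm_add_le (x y : ℝ) :
    ‖((x + y : ℝ) : UnitAddCircle)‖ ≤ ‖(x : UnitAddCircle)‖ + ‖(y : UnitAddCircle)‖ := by
  rw [AddCircle.coe_add]
  exact norm_add_le _ _

theorem torusNorm_sub_le (x y : ℝ) :
    ‖((x - y : ℝ) : UnitAddCircle)‖ ≤ ‖(x : UnitAddCircle)‖ + ‖(y : UnitAddCircle)‖ := by
  rw [AddCircle.coe_sub]
  exact norm_sub_le _ _

theorem torusNorm_sum_le {ι : Type*} (s : Finset ι) (f : ι → ℝ) :
    ‖((∑ i ∈ s, f i : ℝ) : UnitAddCircle)‖ ≤ ∑ i ∈ s, ‖(f i : UnitAddCircle)‖ := by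
  classical
  induction s using Finset.induction_on with
  | empty => simp
  | insert a s ha ih =>
    rw [Finset.sum_insert ha, Finset.sum_insert ha]
    exact (torusNorm_add_le _ _).trans (by gcongr)

theorem torusNorm_sub_intCast (x : ℝ) (m : ℤ) :
    ‖((x - m : ℝ) : UnitAddCircle)‖ = ‖(x : UnitAddCircle)‖ := by
  rw [UnitAddCircle.norm_eq, UnitAddCircle.norm_eq, round_sub_intCast]
  push_cast
  ring_nf

theorem torusNorm_intCast_mul_le (m : ℤ) (x : ℝ) :
    ‖((m * x : ℝ) : UnitAddCircle)‖ ≤ |(m : ℝ)| * ‖(x : UnitAddCircle)‖ := by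
  calc _ ≤ |(m : ℝ) * x - ((m * round x : ℤ) : ℝ)| := torusNorm_le_abs_sub _ _
    _ = |(m : ℝ)| * |x - round x| := by
      rw [← abs_mul]
      push_cast
      ring_nf
    _ = _ := by rw [UnitAddCircle.norm_eq]

theorem torusNorm_natCast_mul_le (m : ℕ) (x : ℝ) :
    ‖((m * x : ℝ) : UnitAddCircle)‖ ≤ m * ‖(x : UnitAddCircle)‖ := by
  simpa using torusNorm_intCast_mul_le m x

theorem norm_expE_sub_one_le (x : ℝ) : ‖expE x - 1‖ ≤ 2 * Real.pi * ‖(x : UnitAddCircle)‖ := by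
  rw [← expE_sub_intCast x (round x), norm_expE_sub_one_eq, UnitAddCircle.norm_eq]
  have := Real.abs_sin_le_abs (x := Real.pi * (x - round x))
  rw [abs_mul, abs_of_pos Real.pi_pos] at this
  linarith

theorem four_mul_torusNorm_le (x : ℝ) : 4 * ‖(x : UnitAddCircle)‖ ≤ ‖expE x - 1‖ := by
  rw [← expE_sub_intCast x (round x), norm_expE_sub_one_eq, UnitAddCircle.norm_eq]
  have h1 : |Real.pi * (x - round x)| = Real.pi * |x - round x| := by
    rw [abs_mul, abs_of_pos Real.pi_pos]
  have h := Real.mul_abs_le_abs_sin (x := Real.pi * (x - round x)) (by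
    rw [h1]
    nlinarith [abs_sub_round x, Real.pi_pos])
  rw [h1, ← mul_assoc, div_mul_cancel₀ _ Real.pi_ne_zero] at h
  linarith

theorem norm_expE_sub_expE_le (x y : ℝ) :
    ‖expE x - expE y‖ ≤ 2 * Real.pi * ‖((x - y : ℝ) : UnitAddCircle)‖ := by
  have : expE x - expE y = expE y * (expE (x - y) - 1) := by
    rw [mul_sub, ← expE_add]
    ring_nf
  rw [this, norm_mul, norm_expE, one_mul]
  exact norm_expE_sub_one_le _

/-! ### Progressions and geometric sums -/

/-- `S` is the set of integers of an interval that lie in one residue class modulo `q`. -/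
def IsStepProg (q : ℤ) (S : Finset ℤ) : Prop :=
  ∃ a b c : ℤ, ∀ n, n ∈ S ↔ a ≤ n ∧ n ≤ b ∧ q ∣ n - c

theorem IsArithProg.exists_isStepProg {S : Finset ℤ} (h : IsArithProg S) :
    ∃ q, 0 < q ∧ IsStepProg q S := by
  obtain ⟨a, q, L, hq, rfl⟩ := h
  refine ⟨q, hq, a, a + q * (L - 1), a, fun n => ?_⟩
  simp only [Finset.mem_image, Finset.mem_range]
  constructor
  · rintro ⟨j, hj, rfl⟩
    have : (j : ℤ) ≤ L - 1 := by omega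
    exact ⟨by nlinarith [Int.natCast_nonneg j], by nlinarith, by simp⟩
  · rintro ⟨h1, h2, j, hj⟩
    have hn : n = a + q * j := by linarith
    subst hn
    have hj0 : 0 ≤ j := by nlinarith
    have hjL : j ≤ L - 1 := by nlinarith
    refine ⟨j.toNat, by omega, ?_⟩
    rw [Int.toNat_of_nonneg hj0]

theorem isStepProg_empty (q : ℤ) : IsStepProg q ∅ :=
  ⟨1, 0, 0, fun n => by simp; omega⟩

/-- Two congruences are either incompatible or amount to one congruence modulo the least common
multiple. This closure property is the reason for describing progressions by membership, with the
empty set allowed. -/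
theorem IsStepProg.inter_residue {q : ℤ} {S : Finset ℤ} (h : IsStepProg q S) (M r a' b' : ℤ) :
    IsStepProg (lcm q M) (S.filter fun n => a' ≤ n ∧ n ≤ b' ∧ M ∣ n - r) := by
  obtain ⟨a, b, c, hS⟩ := h
  by_cases hne : ∃ n, q ∣ n - c ∧ M ∣ n - r
  · obtain ⟨n₀, h1, h2⟩ := hne
    refine ⟨max a a', min b b', n₀, fun n => ?_⟩
    have e1 : q ∣ n - c ↔ q ∣ n - n₀ := by
      rw [show n - c = (n - n₀) + (n₀ - c) by ring]
      exact (Int.dvd_add_left h1)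
    have e2 : M ∣ n - r ↔ M ∣ n - n₀ := by
      rw [show n - r = (n - n₀) + (n₀ - r) by ring]
      exact (Int.dvd_add_left h2)
    rw [Finset.mem_filter, hS, lcm_dvd_iff, e1, e2, max_le_iff, le_min_iff]
    tauto
  · convert isStepProg_empty _
    ext n
    simp only [Finset.mem_filter, hS, Finset.notMem_empty, iff_false]
    push Not at hne
    intro h
    exact hne n h.1.2.2 h.2.2.2

theorem IsStepProg.inter_shift {q : ℤ} {S : Finset ℤ} (h : IsStepProg q S) (t : ℤ) :
    IsStepProg q (S.filter fun n => n + t ∈ S) := by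
  obtain ⟨a, b, c, hS⟩ := h
  have := IsStepProg.inter_residue ⟨a, b, c, hS⟩ q (c - t) (a - t) (b - t)
  -- The lcm of q with itself is only the normalization of q, which has the same multiples.
  rw [lcm_same] at this
  obtain ⟨a', b', c', h'⟩ := this
  refine ⟨a', b', c', fun n => ?_⟩
  have h2 := h' n
  rw [normalize_dvd_iff] at h2
  rw [← h2, Finset.mem_filter, Finset.mem_filter, hS, hS]
  rw [show n + t - c = n - (c - t) by ring]
  constructor <;> rintro ⟨⟨_, _, _⟩, _, _, _⟩ <;> refine ⟨⟨?_, ?_, ?_⟩, ?_, ?_, ?_⟩ <;>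
    first | assumption | omega

/-- Multiplying the sum by e(qγ) translates S by q, and S and its translate differ by at most one
element on each side. Hence the sum times e(qγ) - 1 has norm at most 2. -/
theorem IsStepProg.norm_sum_expE_le {q : ℤ} (hq : 0 < q) {S : Finset ℤ} (h : IsStepProg q S)
    (γ β : ℝ) :
    ‖∑ n ∈ S, expE (γ * n + β)‖ * (2 * ‖((q * γ : ℝ) : UnitAddCircle)‖) ≤ 1 := by
  classical
  obtain ⟨a, b, c, hS⟩ := h
  set T := S.map (Equiv.addRight q).toEmbedding with hT
  have hmemT : ∀ n, n ∈ T ↔ n - q ∈ S := by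
    intro n
    simp only [hT, Finset.mem_map_equiv]
    rfl
  have uniq : ∀ x y : ℤ, q ∣ x - c → q ∣ y - c → x < y + q → y < x + q → x = y := by
    intro x y hx hy h1 h2
    have hd : q ∣ x - y := by simpa using Int.dvd_sub hx hy
    have := Int.eq_zero_of_abs_lt_dvd hd (by rw [abs_lt]; constructor <;> linarith)
    linarith
  have shift : ∀ x : ℤ, q ∣ x - q - c ↔ q ∣ x - c := by
    intro x
    rw [show x - q - c = x - c - q by ring]
    exact dvd_sub_self_right
  have c1 : (S \ T).card ≤ 1 := by
    rw [Finset.card_le_one]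
    intro x hx y hy
    simp only [Finset.mem_sdiff, hmemT, hS, shift] at hx hy
    have hx' : ¬ a ≤ x - q := fun h => hx.2 ⟨h, by linarith, hx.1.2.2⟩
    have hy' : ¬ a ≤ y - q := fun h => hy.2 ⟨h, by linarith, hy.1.2.2⟩
    exact uniq x y hx.1.2.2 hy.1.2.2 (by linarith) (by linarith)
  have c2 : (T \ S).card ≤ 1 := by
    rw [Finset.card_le_one]
    intro x hx y hy
    simp only [Finset.mem_sdiff, hmemT, hS, shift] at hx hy
    have hx' : ¬ x ≤ b := fun h => hx.2 ⟨by linarith, h, hx.1.2.2⟩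
    have hy' : ¬ y ≤ b := fun h => hy.2 ⟨by linarith, h, hy.1.2.2⟩
    exact uniq x y hx.1.2.2 hy.1.2.2 (by linarith) (by linarith)
  set f : ℤ → ℂ := fun n => expE (γ * n + β) with hf
  have hbound : ∀ U : Finset ℤ, U.card ≤ 1 → ‖∑ n ∈ U, f n‖ ≤ 1 := by
    intro U hU
    refine (norm_sum_le _ _).trans ?_
    simp only [hf, norm_expE, Finset.sum_const, nsmul_eq_mul, mul_one]
    exact_mod_cast hU
  have htel : (∑ n ∈ S, f n) * (expE (q * γ) - 1) = ∑ n ∈ T \ S, f n - ∑ n ∈ S \ T, f n := by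
    have h1 : (∑ n ∈ S, f n) * expE (q * γ) = ∑ n ∈ T, f n := by
      rw [hT, Finset.sum_map, Finset.sum_mul]
      refine Finset.sum_congr rfl fun n _ => ?_
      simp only [hf, ← expE_add, Equiv.coe_toEmbedding, Equiv.coe_addRight]
      push_cast
      ring_nf
    have h2 := Finset.sum_sdiff_sub_sum_sdiff (s₁ := S) (s₂ := T) (f := f)
    rw [mul_sub, h1, mul_one, ← h2]
  have h4 := four_mul_torusNorm_le (q * γ)
  have h5 : ‖∑ n ∈ S, f n‖ * ‖expE (q * γ) - 1‖ ≤ 2 := by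
    rw [← norm_mul, htel]
    exact (norm_sub_le _ _).trans (by linarith [hbound _ c1, hbound _ c2])
  nlinarith [norm_nonneg (∑ n ∈ S, f n)]

/-! ### Recurrence of linear phases -/

/-- If `‖γ h‖ ≤ ε` for many `h` in `[-N, N]`, then `γ` is close to a rational with small
denominator. -/
theorem exists_torusNorm_le_of_card {γ ε σ : ℝ} {N : ℕ} {S : Finset ℤ} (hσ : 0 < σ) (hσ1 : σ ≤ 1)
    (hN : 400 ≤ σ ^ 2 * N) (hε0 : 0 ≤ ε) (hε : 192 * ε ≤ σ) (hS : S ⊆ Finset.Icc (-N : ℤ) N)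
    (hcard : σ * N ≤ S.card) (hγ : ∀ h ∈ S, ‖((γ * h : ℝ) : UnitAddCircle)‖ ≤ ε) :
    ∃ t : ℕ, 1 ≤ t ∧ (t : ℝ) * σ ≤ 100 ∧
      ‖((t * γ : ℝ) : UnitAddCircle)‖ * (σ ^ 2 * N) ≤ 800 * ε := by
  classical
  have hN0 : (0 : ℝ) < N := by
    by_contra h
    have : (N : ℝ) = 0 := le_antisymm (not_lt.1 h) (Nat.cast_nonneg N)
    rw [this] at hN
    linarith
  -- Dirichlet approximation with n about 96/σ gives a denominator t ≤ 100/σ and an error η with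
  -- 96|η| ≤ σ.
  obtain ⟨n, hn1, hn2⟩ : ∃ n : ℕ, 96 ≤ σ * n ∧ n * σ ≤ 100 := by
    refine ⟨⌈96 / σ⌉₊, ?_, ?_⟩
    · have := Nat.le_ceil (96 / σ)
      rw [div_le_iff₀ hσ] at this
      linarith
    · have := (Nat.ceil_lt_add_one (show 0 ≤ 96 / σ by positivity)).le
      calc _ ≤ (96 / σ + 1) * σ := by gcongr
        _ = 96 + σ := by field_simp
        _ ≤ 100 := by linarith
  have hn0 : 0 < n := by
    rcases Nat.eq_zero_or_pos n with h | h
    · subst h; norm_num at hn1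
    · exact h
  obtain ⟨j, t', ht0, htn, hjt⟩ := Real.exists_int_int_abs_mul_sub_le γ hn0
  obtain ⟨t, rfl⟩ := Int.eq_ofNat_of_zero_le ht0.le
  have ht1 : 1 ≤ t := by exact_mod_cast ht0
  have htn' : (t : ℝ) ≤ n := by exact_mod_cast htn
  set η : ℝ := γ * t - j with hη
  have hjt : |η| ≤ 1 / (n + 1) := by
    rw [hη, mul_comm]; exact_mod_cast hjt
  have htσ : (t : ℝ) * σ ≤ 100 := le_trans (by gcongr) hn2
  refine ⟨t, ht1, htσ, ?_⟩
  have hle : ‖((t * γ : ℝ) : UnitAddCircle)‖ ≤ |η| := by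
    rw [hη, mul_comm]
    exact torusNorm_le_abs_sub _ j
  rcases eq_or_ne η 0 with h0 | h0
  · rw [h0, abs_zero] at hle
    have : ‖((t * γ : ℝ) : UnitAddCircle)‖ = 0 := le_antisymm hle (norm_nonneg _)
    rw [this]; linarith
  have hη0 : 0 < |η| := abs_pos.2 h0
  have hησ : 96 * |η| ≤ σ := by
    rw [le_div_iff₀ (by positivity)] at hjt
    nlinarith
  -- Along W steps of length t the phase drifts, modulo 1, by at most W|η| ≤ 1/4. It cannot wrap
  -- around, so it meets the ε-neighbourhood of the integers in one short run.
  obtain ⟨W, hW1, hW2⟩ : ∃ W : ℕ, 1 ≤ W * (8 * |η|) ∧ W * (4 * |η|) ≤ 1 := by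
    have hpos : 0 < 4 * |η| := by positivity
    refine ⟨⌊1 / (4 * |η|)⌋₊, ?_, ?_⟩
    · have h2 := Nat.lt_floor_add_one (1 / (4 * |η|))
      rw [div_lt_iff₀ hpos] at h2
      linarith
    · have := Nat.floor_le (show 0 ≤ 1 / (4 * |η|) by positivity)
      rwa [le_div_iff₀ hpos] at this
  -- every window of length `W` with step `t` contains few elements of `S`
  have hwin : ∀ h : ℤ, (((Finset.range W).filter fun m : ℕ => h + t * (m : ℤ) ∈ S).card : ℝ)
      ≤ 2 * ε / |η| + 1 := by
    intro h
    set U := (Finset.range W).filter fun m : ℕ => h + t * (m : ℤ) ∈ S with hU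
    rcases U.eq_empty_or_nonempty with he | hne
    · rw [he]; simp; positivity
    set m₀ := U.min' hne with hm₀
    have hm₀U : m₀ ∈ U := Finset.min'_mem _ _
    have hsub : U ⊆ Finset.Icc m₀ (m₀ + ⌊2 * ε / |η|⌋₊) := by
      intro m hm
      have hle : m₀ ≤ m := Finset.min'_le _ _ hm
      rw [Finset.mem_Icc]
      refine ⟨hle, ?_⟩
      obtain ⟨u, rfl⟩ := Nat.exists_eq_add_of_le hle
      rw [add_le_add_iff_left]
      apply Nat.le_floor
      rw [le_div_iff₀ hη0]
      rw [hU, Finset.mem_filter, Finset.mem_range] at hm hm₀U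
      have e1 := hγ _ hm.2
      have e2 := hγ _ hm₀U.2
      have e3 : γ * ((h + t * ((m₀ + u : ℕ) : ℤ) : ℤ) : ℝ) - γ * ((h + t * (m₀ : ℤ) : ℤ) : ℝ)
          = u * η + ((u * j : ℤ) : ℝ) := by
        rw [hη]; push_cast; ring
      have e4 := torusNorm_sub_le (γ * ((h + t * ((m₀ + u : ℕ) : ℤ) : ℤ) : ℝ))
        (γ * ((h + t * (m₀ : ℤ) : ℤ) : ℝ))
      have huW : (u : ℝ) ≤ W := by
        have : u ≤ W := by omega
        exact_mod_cast this
      have habs : |(u : ℝ) * η| = u * |η| := by rw [abs_mul, Nat.abs_cast]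
      have e5 : ‖((u * η : ℝ) : UnitAddCircle)‖ = u * |η| := by
        rw [← habs]
        apply torusNorm_of_abs_le_half
        rw [habs]
        nlinarith
      rw [e3, ← torusNorm_sub_intCast _ (u * j), add_sub_cancel_right, e5] at e4
      linarith
    have := Finset.card_le_card hsub
    rw [Nat.card_Icc] at this
    have h3 : (U.card : ℝ) ≤ ⌊2 * ε / |η|⌋₊ + 1 := by
      have : U.card ≤ ⌊2 * ε / |η|⌋₊ + 1 := by omega
      exact_mod_cast this
    have := Nat.floor_le (show 0 ≤ 2 * ε / |η| by positivity)
    linarith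
  -- Double counting: each element of S lies in W windows, one for each position m, and the possible
  -- starting points form [-N - tW, N].
  have hcount : (W : ℝ) * S.card ≤ (2 * N + t * W + 1) * (2 * ε / |η| + 1) := by
    set I := Finset.Icc (-(N : ℤ) - t * W) N with hI
    have h1 : ∑ h ∈ I, ((Finset.range W).filter fun m : ℕ => h + t * (m : ℤ) ∈ S).card
        = ∑ m ∈ Finset.range W, (I.filter fun h : ℤ => h + t * (m : ℤ) ∈ S).card := by
      simp only [Finset.card_filter]
      exact Finset.sum_comm
    have h2 : ∀ m ∈ Finset.range W, S.card ≤ (I.filter fun h : ℤ => h + t * (m : ℤ) ∈ S).card := by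
      intro m hm
      rw [Finset.mem_range] at hm
      refine Finset.card_le_card_of_injOn (fun s => s - t * (m : ℤ)) ?_ ?_
      · intro s hs
        have := Finset.mem_Icc.1 (hS hs)
        simp only [Finset.coe_filter, Set.mem_ofPred_eq, sub_add_cancel, hI, Finset.mem_Icc]
        refine ⟨⟨?_, ?_⟩, hs⟩
        · have : (t : ℤ) * m ≤ t * W := by
            have : (m : ℤ) ≤ W := by exact_mod_cast hm.le
            gcongr
          linarith
        · have : (0 : ℤ) ≤ t * m := by positivity
          linarith
      · intro a _ b _ hab
        simpa using hab
    have h3 : W * S.card ≤ ∑ h ∈ I,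
        ((Finset.range W).filter fun m : ℕ => h + t * (m : ℤ) ∈ S).card := by
      rw [h1]
      simpa using Finset.card_nsmul_le_sum _ _ _ h2
    have h4 : (∑ h ∈ I, (((Finset.range W).filter fun m : ℕ => h + t * (m : ℤ) ∈ S).card : ℝ))
        ≤ I.card * (2 * ε / |η| + 1) := by
      rw [← nsmul_eq_mul]
      exact Finset.sum_le_card_nsmul I _ _ (fun h _ => hwin h)
    have h5 : (I.card : ℝ) = 2 * N + t * W + 1 := by
      rw [hI, Int.card_Icc]
      have : ((((N : ℤ) + 1 - (-(N : ℤ) - t * W)).toNat : ℤ) : ℝ) = 2 * N + t * W + 1 := by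
        rw [Int.toNat_of_nonneg]
        · push_cast; ring
        · have : (0 : ℤ) ≤ t * W := by positivity
          linarith
      exact_mod_cast this
    rw [h5] at h4
    refine le_trans ?_ h4
    exact_mod_cast h3
  have hW0 : (0 : ℝ) < W := by
    by_contra h
    have : (W : ℝ) = 0 := le_antisymm (not_lt.1 h) (Nat.cast_nonneg W)
    rw [this] at hW1
    linarith
  have hN1 : (1 : ℝ) ≤ N := by
    have : 0 < N := by exact_mod_cast hN0
    exact_mod_cast this
  have hfin : (S.card : ℝ) ≤ (24 * N * |η| + t) * (2 * ε / |η| + 1) := by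
    have hB : 0 ≤ 2 * ε / |η| + 1 := by positivity
    have : (W : ℝ) * S.card ≤ W * ((24 * N * |η| + t) * (2 * ε / |η| + 1)) := by
      refine hcount.trans ?_
      rw [← mul_assoc]
      gcongr
      nlinarith
    exact le_of_mul_le_mul_left this hW0
  have hexp : (24 * N * |η| + t) * (2 * ε / |η| + 1)
      = 48 * N * ε + 24 * N * |η| + 2 * t * ε / |η| + t := by
    field_simp
    ring
  rw [hexp] at hfin
  have ht4 : (t : ℝ) ≤ σ * N / 4 := by
    have : (t : ℝ) * σ ≤ (σ * N / 4) * σ := by nlinarith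
    exact le_of_mul_le_mul_right this hσ
  -- Of the four terms bounding σN, the other three are at most σN/4 each, by 192ε ≤ σ, 96|η| ≤ σ
  -- and 400 ≤ σ²N. The remaining term bounds |η|.
  have hmain : σ * N / 4 ≤ 2 * t * ε / |η| := by nlinarith
  rw [le_div_iff₀ hη0] at hmain
  calc _ ≤ |η| * (σ ^ 2 * N) := by gcongr
    _ = 4 * σ * (σ * N / 4 * |η|) := by ring
    _ ≤ 4 * σ * (2 * t * ε) := by gcongr
    _ = 8 * ε * (t * σ) := by ring
    _ ≤ 8 * ε * 100 := by gcongr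
    _ = _ := by ring

/-! ### Cauchy–Schwarz in one coordinate -/

/-- The map that exchanges m with the i-th coordinate of n is an involution of the box times its
i-th side. -/
theorem sum_piFinset_update_swap {D : ℕ} {M : Type*} [AddCommMonoid M] (E : Fin D → Finset ℤ)
    (i : Fin D) (g : (Fin D → ℤ) → ℤ → M) :
    ∑ n ∈ Fintype.piFinset E, ∑ m ∈ E i, g (Function.update n i m) (n i)
      = ∑ n ∈ Fintype.piFinset E, ∑ m ∈ E i, g n m := by
  rw [← Finset.sum_product', ← Finset.sum_product']
  have hmem : ∀ a ∈ Fintype.piFinset E ×ˢ E i,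
      (Function.update a.1 i a.2, a.1 i) ∈ Fintype.piFinset E ×ˢ E i := by
    rintro ⟨n, m⟩ h
    simp only [Finset.mem_product, Fintype.mem_piFinset] at h ⊢
    refine ⟨fun j => ?_, h.1 i⟩
    rcases eq_or_ne j i with rfl | hj
    · simpa using h.2
    · simpa [hj] using h.1 j
  have hinv : ∀ a ∈ Fintype.piFinset E ×ˢ E i,
      (Function.update (Function.update a.1 i a.2) i (a.1 i), Function.update a.1 i a.2 i) = a := by
    rintro ⟨n, m⟩ h
    simp
  exact Finset.sum_nbij' (fun a => (Function.update a.1 i a.2, a.1 i))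
    (fun a => (Function.update a.1 i a.2, a.1 i)) hmem hmem hinv hinv (fun _ _ => rfl)

theorem card_mul_norm_sum_le {D : ℕ} (E : Fin D → Finset ℤ) (i : Fin D) (f : (Fin D → ℤ) → ℂ) :
    ((E i).card : ℝ) * ‖∑ n ∈ Fintype.piFinset E, f n‖
      ≤ ∑ n ∈ Fintype.piFinset E, ‖∑ m ∈ E i, f (Function.update n i m)‖ := by
  have h := sum_piFinset_update_swap E i (fun n _ => f n)
  have h2 : ((E i).card : ℂ) * ∑ n ∈ Fintype.piFinset E, f n
      = ∑ n ∈ Fintype.piFinset E, ∑ m ∈ E i, f (Function.update n i m) := by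
    rw [h, Finset.mul_sum]
    simp
  calc _ = ‖((E i).card : ℂ) * ∑ n ∈ Fintype.piFinset E, f n‖ := by simp
    _ ≤ _ := by
      rw [h2]
      exact norm_sum_le _ _

open ComplexConjugate in
-- Cauchy–Schwarz is applied to the sums over lines parallel to e_i. Each line is counted once per
-- point on it, which gives a factor |E_i|; one such factor cancels.
theorem card_mul_norm_sum_sq_le {D : ℕ} (E : Fin D → Finset ℤ) (i : Fin D)
    (f : (Fin D → ℤ) → ℂ) :
    ((E i).card : ℝ) * ‖∑ n ∈ Fintype.piFinset E, f n‖ ^ 2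
      ≤ (Fintype.piFinset E).card *
        ‖∑ n ∈ Fintype.piFinset E, ∑ m ∈ E i, f (Function.update n i m) * conj (f n)‖ := by
  rcases (E i).eq_empty_or_nonempty with h0 | h0
  · rw [h0]; simp
  have hc : (0 : ℝ) < (E i).card := by exact_mod_cast h0.card_pos
  set F : (Fin D → ℤ) → ℂ := fun n => ∑ m ∈ E i, f (Function.update n i m) with hF
  have h1 : ((∑ n ∈ Fintype.piFinset E, ‖F n‖ ^ 2 : ℝ) : ℂ)
      = (E i).card * ∑ n ∈ Fintype.piFinset E, ∑ m ∈ E i,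
        f (Function.update n i m) * conj (f n) := by
    have e1 : ∀ n, ((‖F n‖ ^ 2 : ℝ) : ℂ)
        = ∑ m ∈ E i, F (Function.update n i m) * conj (f (Function.update n i m)) := by
      intro n
      have : ∀ m, F (Function.update n i m) = F n := fun m => by simp [hF]
      simp_rw [this, ← Finset.mul_sum, ← map_sum]
      rw [Complex.mul_conj, Complex.normSq_eq_norm_sq]
    push_cast at e1 ⊢
    simp_rw [e1]
    rw [sum_piFinset_update_swap E i (fun n _ => F n * conj (f n)), Finset.mul_sum]
    refine Finset.sum_congr rfl fun n _ => ?_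
    rw [Finset.sum_const, nsmul_eq_mul, hF, Finset.sum_mul]
  have h2 := card_mul_norm_sum_le E i f
  have h3 : (∑ n ∈ Fintype.piFinset E, ‖F n‖) ^ 2
      ≤ (Fintype.piFinset E).card * ∑ n ∈ Fintype.piFinset E, ‖F n‖ ^ 2 :=
    sq_sum_le_card_mul_sum_sq
  have h4 : ∑ n ∈ Fintype.piFinset E, ‖F n‖ ^ 2
      = (E i).card * ‖∑ n ∈ Fintype.piFinset E, ∑ m ∈ E i,
        f (Function.update n i m) * conj (f n)‖ := by
    have h := congrArg norm h1
    rw [norm_mul, Complex.norm_real, Complex.norm_natCast, Real.norm_of_nonneg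
      (Finset.sum_nonneg fun _ _ => by positivity)] at h
    exact h
  have h5 : ((E i).card * ‖∑ n ∈ Fintype.piFinset E, f n‖) ^ 2
      ≤ (∑ n ∈ Fintype.piFinset E, ‖F n‖) ^ 2 := by
    gcongr
  rw [h4] at h3
  refine le_of_mul_le_mul_left (a := ((E i).card : ℝ)) ?_ hc
  calc _ = ((E i).card * ‖∑ n ∈ Fintype.piFinset E, f n‖) ^ 2 := by ring
    _ ≤ _ := h5.trans h3
    _ = _ := by ring

theorem update_eq_add_single {D : ℕ} (n : Fin D → ℤ) (i : Fin D) (m : ℤ) :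
    Function.update n i m = n + Pi.single i (m - n i) := by
  ext j
  rcases eq_or_ne j i with rfl | hj
  · simp
  · simp [hj]

/-- The sides of the box `E ∩ (E - h e_i)`. -/
def shiftInter {D : ℕ} (E : Fin D → Finset ℤ) (i : Fin D) (h : ℤ) : Fin D → Finset ℤ :=
  Function.update E i ((E i).filter fun m => m + h ∈ E i)

theorem shiftInter_subset {D : ℕ} (E : Fin D → Finset ℤ) (i : Fin D) (h : ℤ) (j : Fin D) :
    shiftInter E i h j ⊆ E j := by
  rcases eq_or_ne j i with rfl | hj
  · simp [shiftInter]
  · simp [shiftInter, hj]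

theorem filter_piFinset_eq_shiftInter {D : ℕ} (E : Fin D → Finset ℤ) (i : Fin D) (h : ℤ) :
    (Fintype.piFinset E).filter (fun n => n i + h ∈ E i) = Fintype.piFinset (shiftInter E i h) := by
  ext n
  simp only [Finset.mem_filter, Fintype.mem_piFinset, shiftInter]
  constructor
  · rintro ⟨h1, h2⟩ j
    rcases eq_or_ne j i with rfl | hj
    · simp [h1 j, h2]
    · simp [hj, h1 j]
  · intro h1
    have h2 := h1 i
    simp only [Function.update_self, Finset.mem_filter] at h2
    refine ⟨fun j => ?_, h2.2⟩
    rcases eq_or_ne j i with rfl | hj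
    · exact h2.1
    · simpa [hj] using h1 j

/-- Substituting h = m - n_i turns pairs of points on a line into a shift and a point of the box met
with its translate. The factor 2 in the hypothesis ensures |h| ≤ N. -/
theorem sum_sum_update_eq {D : ℕ} (E : Fin D → Finset ℤ) (i : Fin D) (N : ℕ)
    (hE : ∀ m ∈ E i, 2 * |m| ≤ N) (g : (Fin D → ℤ) → (Fin D → ℤ) → ℂ) :
    ∑ n ∈ Fintype.piFinset E, ∑ m ∈ E i, g (Function.update n i m) n
      = ∑ h ∈ Finset.Icc (-N : ℤ) N, ∑ n ∈ Fintype.piFinset (shiftInter E i h),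
        g (n + Pi.single i h) n := by
  simp_rw [← filter_piFinset_eq_shiftInter, Finset.sum_filter]
  conv_rhs => rw [Finset.sum_comm]
  refine Finset.sum_congr rfl fun n hn => ?_
  rw [← Finset.sum_filter]
  have hni := Fintype.mem_piFinset.1 hn i
  refine Finset.sum_nbij' (fun m => m - n i) (fun h => n i + h) ?_ ?_ ?_ ?_ ?_
  · intro m hm
    have h1 := hE m hm
    have h2 := hE _ hni
    simp only [Finset.mem_filter, Finset.mem_Icc, add_sub_cancel, hm, and_true]
    rw [← abs_le]
    have := abs_sub m (n i)
    linarith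
  · intro h hh
    exact (Finset.mem_filter.1 hh).2
  · intro m _
    ring
  · intro h _
    ring
  · intro m _
    rw [update_eq_add_single]

/-! ### Sizes of boxes and of steps -/

theorem card_le_of_abs_le {S : Finset ℤ} {r : ℝ} (hr : 1 ≤ r) (hS : ∀ m ∈ S, |(m : ℝ)| ≤ r) :
    (S.card : ℝ) ≤ 3 * r := by
  have hsub : S ⊆ Finset.Icc (-(⌊r⌋₊ : ℤ)) ⌊r⌋₊ := by
    intro m hm
    rw [Finset.mem_Icc]
    have h := hS m hm
    have : m.natAbs ≤ ⌊r⌋₊ := by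
      apply Nat.le_floor
      rw [Nat.cast_natAbs]
      exact_mod_cast h
    omega
  have h1 := Finset.card_le_card hsub
  rw [Int.card_Icc] at h1
  have h2 : S.card ≤ 2 * ⌊r⌋₊ + 1 := by omega
  have h3 : (S.card : ℝ) ≤ 2 * ⌊r⌋₊ + 1 := by exact_mod_cast h2
  have h4 := Nat.floor_le (by linarith : 0 ≤ r)
  linarith

theorem card_piFinset_le {D : ℕ} {R : Fin D → ℝ} (hR : ∀ i, 1 ≤ R i) {E : Fin D → Finset ℤ}
    (hE : ∀ i, ∀ m ∈ E i, |(m : ℝ)| ≤ R i) :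
    ((Fintype.piFinset E).card : ℝ) ≤ 3 ^ D * ∏ i, R i := by
  rw [Fintype.card_piFinset]
  push_cast
  calc _ ≤ ∏ i, 3 * R i := by
        gcongr with i
        exact card_le_of_abs_le (hR i) (hE i)
    _ = _ := by
      rw [Finset.prod_mul_distrib]
      simp

theorem mul_card_piFinset_le {D : ℕ} {R : Fin D → ℝ} (hR : ∀ i, 1 ≤ R i) {E : Fin D → Finset ℤ}
    (hE : ∀ i, ∀ m ∈ E i, |(m : ℝ)| ≤ R i) (i : Fin D) :
    R i * (Fintype.piFinset E).card ≤ 3 ^ D * (∏ i, R i) * (E i).card := by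
  have hpos : ∀ j, 0 < R j := fun j => by linarith [hR j]
  rw [Fintype.card_piFinset]
  push_cast
  rw [← Finset.mul_prod_erase _ _ (Finset.mem_univ i),
    ← Finset.mul_prod_erase _ R (Finset.mem_univ i)]
  have h1 : ∏ j ∈ Finset.univ.erase i, ((E j).card : ℝ)
      ≤ 3 ^ D * ∏ j ∈ Finset.univ.erase i, R j := by
    calc _ ≤ ∏ j ∈ Finset.univ.erase i, 3 * R j := by
          gcongr with j
          exact card_le_of_abs_le (hR j) (hE j)
      _ = 3 ^ (Finset.univ.erase i).card * ∏ j ∈ Finset.univ.erase i, R j := by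
          rw [Finset.prod_mul_distrib, Finset.prod_const]
      _ ≤ _ := by
          have h0 : 0 ≤ ∏ j ∈ Finset.univ.erase i, R j := Finset.prod_nonneg fun j _ => (hpos j).le
          gcongr
          · norm_num
          · simp
  calc _ = (R i * (E i).card) * ∏ j ∈ Finset.univ.erase i, ((E j).card : ℝ) := by ring
    _ ≤ (R i * (E i).card) * (3 ^ D * ∏ j ∈ Finset.univ.erase i, R j) := by
      have := (hpos i).le
      gcongr
    _ = _ := by ring

theorem IsStepProg.mul_card_le {q : ℤ} (hq : 0 < q) {S : Finset ℤ} (h : IsStepProg q S) {r : ℝ}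
    (hr : 0 ≤ r) (hS : ∀ m ∈ S, |(m : ℝ)| ≤ r) : (q : ℝ) * (S.card - 1) ≤ 2 * r := by
  obtain ⟨a, b, c, habc⟩ := h
  have hq' : (0 : ℝ) < q := by exact_mod_cast hq
  rcases S.eq_empty_or_nonempty with he | hne
  · rw [he]; simp; linarith
  set m₀ := S.min' hne
  have hm₀ : m₀ ∈ S := S.min'_mem hne
  have hcard : S.card ≤ (Finset.Icc (0 : ℤ) ⌊2 * r / q⌋).card := by
    refine Finset.card_le_card_of_injOn (fun m => (m - m₀) / q) ?_ ?_
    · intro m hm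
      have h1 : m₀ ≤ m := Finset.min'_le _ _ hm
      have h2 := abs_le.1 (hS m hm)
      have h3 := abs_le.1 (hS _ hm₀)
      simp only [Finset.coe_Icc, Set.mem_Icc]
      refine ⟨Int.ediv_nonneg (by linarith) hq.le, ?_⟩
      rw [Int.le_floor, le_div_iff₀ hq']
      have h4 : ((m - m₀) / q) * q ≤ m - m₀ := Int.ediv_mul_le _ hq.ne'
      have h5 : (((m - m₀) / q : ℤ) : ℝ) * q ≤ m - m₀ := by exact_mod_cast h4
      linarith
    · intro x hx y hy hxy
      have hd : ∀ z ∈ S, q ∣ z - m₀ := by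
        intro z hz
        have h1 := ((habc z).1 hz).2.2
        have h2 := ((habc m₀).1 hm₀).2.2
        simpa using Int.dvd_sub h1 h2
      have := congrArg (· * q) hxy
      simp only [Int.ediv_mul_cancel (hd x hx), Int.ediv_mul_cancel (hd y hy)] at this
      linarith
  rw [Int.card_Icc] at hcard
  have hf : 0 ≤ ⌊2 * r / q⌋ := Int.floor_nonneg.2 (by positivity)
  have h1 : (S.card : ℤ) - 1 ≤ ⌊2 * r / q⌋ := by omega
  rw [Int.le_floor, le_div_iff₀ hq'] at h1
  push_cast at h1
  linarith

/-! ### Weyl differencing -/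

/-- Iterated differencing of `p` in the coordinate directions of `l` with steps `h₁, h₂, …` gives
the constant `γ h₁ h₂ ⋯`. -/
def HasTop {D : ℕ} : List (Fin D) → ℝ → ((Fin D → ℤ) → ℝ) → Prop
  | [], γ, p => ∀ n, p n = γ
  | i :: l, γ, p => ∀ h : ℤ, HasTop l (γ * h) (fun n => p (n + Pi.single i h) - p n)

theorem le_pow_of_le_two_pow {K : ℝ} (hK : 2 ≤ K) {c : ℝ} (a : ℕ) (hc : c ≤ 2 ^ a) : c ≤ K ^ a :=
  hc.trans (by gcongr)

theorem three_pow_le {K : ℝ} (hK : 2 ≤ K) (D : ℕ) : (3 : ℝ) ^ D ≤ K ^ (2 * D) := by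
  rw [pow_mul]
  gcongr
  nlinarith

/-- A box of density 1/K has i-th side with at least R_i/K^(2D+1) elements, and a long progression
inside [-R_i, R_i] has small step. The lower bound on R_i absorbs the endpoint error. -/
theorem IsStepProg.step_le {D : ℕ} {K : ℝ} (hK : 2 ≤ K) {R : Fin D → ℝ}
    (hR : ∀ i, K ^ (2 * D + 2) ≤ R i) {E : Fin D → Finset ℤ}
    (hE : ∀ i, ∀ m ∈ E i, |(m : ℝ)| ≤ R i) {i : Fin D} {q : ℤ} (hq : 0 < q)
    (hEi : IsStepProg q (E i)) (hcard : (∏ i, R i) / K ≤ (Fintype.piFinset E).card) :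
    (q : ℝ) ≤ K ^ (2 * D + 3) := by
  have hK1 : 1 ≤ K := by linarith
  have hR1 : ∀ i, 1 ≤ R i := fun i => (one_le_pow₀ hK1).trans (hR i)
  have hR0 : ∀ i, 0 < R i := fun i => by linarith [hR1 i]
  have hprod : 0 < ∏ i, R i := Finset.prod_pos fun i _ => hR0 i
  have hq' : (1 : ℝ) ≤ q := by exact_mod_cast hq
  have h1 := mul_card_piFinset_le hR1 hE i
  have h2 := hEi.mul_card_le hq (hR0 i).le (hE i)
  have h3 := three_pow_le hK D
  have hK0 : 0 < K := by linarith
  have h4 : R i ≤ K ^ (2 * D) * K * (E i).card := by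
    have : R i * ((∏ i, R i) / K) ≤ 3 ^ D * (∏ i, R i) * (E i).card :=
      le_trans (by have := (hR0 i).le; gcongr) h1
    have h5 : (∏ i, R i) * R i ≤ (∏ i, R i) * (3 ^ D * K * (E i).card) := by
      rw [← mul_div_assoc, div_le_iff₀ hK0] at this
      linarith
    refine (le_of_mul_le_mul_left h5 hprod).trans ?_
    gcongr
  have h6 : K ^ (2 * D) * K * 2 ≤ R i := by
    refine le_trans ?_ (hR i)
    rw [pow_add, mul_assoc, pow_two]
    gcongr
  have hP : 0 < K ^ (2 * D) := by positivity
  -- `q R ≤ q K^(2D+1) #E ≤ K^(2D+1) (2 R + q)`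
  have h7 : q * R i ≤ K ^ (2 * D) * K * (2 * R i + q) := by
    calc _ ≤ q * (K ^ (2 * D) * K * (E i).card) := by gcongr
      _ = K ^ (2 * D) * K * (q * ((E i).card - 1) + q) := by ring
      _ ≤ _ := by gcongr
  have h8 : q * R i ≤ (4 * (K ^ (2 * D) * K)) * R i := by nlinarith
  have h9 := le_of_mul_le_mul_right h8 (hR0 i)
  refine h9.trans ?_
  have : K ^ (2 * D + 3) = K ^ 2 * (K ^ (2 * D) * K) := by ring
  rw [this]
  gcongr
  nlinarith

/-- The phase is linear on each line parallel to e_i, so the sum along the line is geometric. The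
denominator Q is the step q_i itself. -/
theorem exists_torusNorm_le_of_hasTop_singleton {D : ℕ} {K : ℝ} (hK : 2 ≤ K) {R : Fin D → ℝ}
    (hR : ∀ i, K ^ (2 * D + 3) ≤ R i) {q : Fin D → ℤ} (hq : ∀ i, 0 < q i) {E : Fin D → Finset ℤ}
    (hqE : ∀ i, IsStepProg (q i) (E i)) (hE : ∀ i, ∀ m ∈ E i, |(m : ℝ)| ≤ R i) {i : Fin D}
    {γ : ℝ} {p : (Fin D → ℤ) → ℝ} (hp : HasTop [i] γ p)
    (hsum : (∏ i, R i) / K ≤ ‖∑ n ∈ Fintype.piFinset E, expE (p n)‖) :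
    ∃ Q : ℕ, 1 ≤ Q ∧ (Q : ℝ) ≤ K ^ (2 * D + 3) ∧
      ‖((Q * γ : ℝ) : UnitAddCircle)‖ * R i ≤ K ^ (2 * D + 3) := by
  have hK1 : 1 ≤ K := by linarith
  have hK0 : 0 < K := by linarith
  have hR1 : ∀ i, 1 ≤ R i := fun i => (one_le_pow₀ hK1).trans (hR i)
  have hR0 : ∀ i, 0 < R i := fun i => by linarith [hR1 i]
  have hprod : 0 < ∏ i, R i := Finset.prod_pos fun i _ => hR0 i
  have hcard : (∏ i, R i) / K ≤ (Fintype.piFinset E).card := by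
    refine hsum.trans ((norm_sum_le _ _).trans ?_)
    simp [norm_expE]
  have hqK := (hqE i).step_le hK
    (fun j => (pow_le_pow_right₀ hK1 (by omega)).trans (hR j)) hE (hq i) hcard
  obtain ⟨Q, hQ⟩ := Int.eq_ofNat_of_zero_le (hq i).le
  have hQ' : (q i : ℝ) = Q := by rw [hQ]; simp
  refine ⟨Q, by have := hq i; omega, hQ' ▸ hqK, ?_⟩
  have h1 := mul_card_piFinset_le hR1 hE i
  have h2 := card_mul_norm_sum_le E i (fun n => expE (p n))
  have hEpos : (0 : ℝ) < (E i).card := by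
    rw [Nat.cast_pos, Finset.card_pos, Finset.nonempty_iff_ne_empty]
    intro h0
    have : Fintype.piFinset E = ∅ := by
      rw [Finset.eq_empty_iff_forall_notMem]
      intro n hn
      have := Fintype.mem_piFinset.1 hn i
      simp [h0] at this
    rw [this] at hcard
    have : 0 < (∏ i, R i) / K := by positivity
    simp at hcard
    linarith
  set τ : ℝ := ‖((Q * γ : ℝ) : UnitAddCircle)‖ with hτ
  have hτ0 : 0 ≤ τ := norm_nonneg _
  have h3 : ∀ n, ‖∑ m ∈ E i, expE (p (Function.update n i m))‖ * (2 * τ) ≤ 1 := by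
    intro n
    have e : ∀ m : ℤ, p (Function.update n i m) = γ * m + (p n - γ * n i) := by
      intro m
      have := hp (m - n i) n
      beta_reduce at this
      rw [← update_eq_add_single] at this
      push_cast at this
      linarith
    simp_rw [e]
    have := (hqE i).norm_sum_expE_le (hq i) γ (p n - γ * n i)
    rwa [hQ'] at this
  have h4 : (E i).card * ‖∑ n ∈ Fintype.piFinset E, expE (p n)‖ * (2 * τ)
      ≤ (Fintype.piFinset E).card := by
    refine (mul_le_mul_of_nonneg_right h2 (by positivity)).trans ?_
    rw [Finset.sum_mul]
    refine (Finset.sum_le_sum fun n _ => h3 n).trans ?_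
    simp
  have h5 : ((E i).card * (∏ i, R i)) * (R i * (2 * τ) / K)
      ≤ ((E i).card * (∏ i, R i)) * 3 ^ D := by
    calc _ = R i * ((E i).card * ((∏ i, R i) / K) * (2 * τ)) := by ring
      _ ≤ R i * ((E i).card * ‖∑ n ∈ Fintype.piFinset E, expE (p n)‖ * (2 * τ)) := by
        have := (hR0 i).le
        gcongr
      _ ≤ R i * (Fintype.piFinset E).card := by
        have := (hR0 i).le
        gcongr
      _ ≤ _ := h1
      _ = _ := by ring
  have h6 := le_of_mul_le_mul_left h5 (by positivity)
  rw [div_le_iff₀ hK0] at h6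
  have h7 := three_pow_le hK D
  calc τ * R i ≤ R i * (2 * τ) := by nlinarith [hR0 i]
    _ ≤ 3 ^ D * K := h6
    _ ≤ K ^ (2 * D) * K ^ 3 := by
      gcongr
      exact le_self_pow₀ hK1 (by norm_num)
    _ = _ := by ring

theorem sum_le_mul_card_filter_add {ι : Type*} (s : Finset ι) (f : ι → ℝ) {A T : ℝ} (hT : 0 ≤ T)
    (hA : ∀ i ∈ s, f i ≤ A) :
    ∑ i ∈ s, f i ≤ A * (s.filter fun i => T ≤ f i).card + T * s.card := by
  rw [← Finset.sum_filter_add_sum_filter_not s (fun i => T ≤ f i)]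
  refine add_le_add ?_ ?_
  · rw [mul_comm, ← nsmul_eq_mul]
    exact Finset.sum_le_card_nsmul _ _ _ fun i hi => hA i (Finset.mem_filter.1 hi).1
  · calc _ ≤ (s.filter fun i => ¬ T ≤ f i).card • T :=
          Finset.sum_le_card_nsmul _ _ _ fun i hi => (not_le.1 (Finset.mem_filter.1 hi).2).le
      _ ≤ _ := by
        rw [nsmul_eq_mul, mul_comm]
        gcongr
        exact Finset.filter_subset _ _

theorem mul_sq_le_of_le {r e z x b y s A : ℝ} (hr : 0 ≤ r) (he : 0 < e) (hz : 0 ≤ z) (hzx : z ≤ x)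
    (h1 : e * x ^ 2 ≤ b * y) (h2 : y ≤ s) (h3 : r * b ≤ A * e) (hs : 0 ≤ s)
    (hb : 0 ≤ b) :
    r * z ^ 2 ≤ A * s := by
  refine le_of_mul_le_mul_left ?_ he
  calc e * (r * z ^ 2) ≤ e * (r * x ^ 2) := by gcongr
    _ = r * (e * x ^ 2) := by ring
    _ ≤ r * (b * s) := by
      exact mul_le_mul_of_nonneg_left (h1.trans (mul_le_mul_of_nonneg_left h2 hb)) hr
    _ = (r * b) * s := by ring
    _ ≤ (A * e) * s := by gcongr
    _ = _ := by ring

/-- The arithmetic at the end of `card_large_differences`, with P = K^(2D), A = 3^D, H the number of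
good shifts and c the number of all shifts. At the threshold ρ/(P K^6), the bad shifts contribute at
most r/2, since 10 ≤ K^4. -/
theorem le_of_sq_le_of_card {K P A ρ r s H c : ℝ} (hK : 2 ≤ K) (hP0 : 0 < P) (hρ : 0 < ρ)
    (hr : 0 ≤ r) (hA0 : 0 ≤ A) (hA : A ≤ P) (hH : 0 ≤ H) (h1 : r * (ρ / K) ^ 2 ≤ A * ρ * s)
    (h2 : s ≤ A * ρ * H + ρ / (P * K ^ 6) * c) (h3 : c ≤ 5 * r) : r ≤ P ^ 2 * K ^ 3 * H := by
  have hK0 : 0 < K := by linarith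
  have h7 : ρ ^ 2 * (r / K ^ 2) ≤ ρ ^ 2 * (P * (P * H + 5 * r / (P * K ^ 6))) := by
    have h4 : s ≤ P * ρ * H + ρ / (P * K ^ 6) * (5 * r) := h2.trans (by gcongr)
    calc _ = r * (ρ / K) ^ 2 := by ring
      _ ≤ _ := h1
      _ ≤ A * ρ * (P * ρ * H + ρ / (P * K ^ 6) * (5 * r)) := by gcongr
      _ ≤ P * ρ * (P * ρ * H + ρ / (P * K ^ 6) * (5 * r)) := by gcongr
      _ = _ := by ring
  have h8 := le_of_mul_le_mul_left h7 (by positivity)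
  have h9 : r ≤ P ^ 2 * K ^ 2 * H + 5 * r / K ^ 4 := by
    rw [div_le_iff₀ (by positivity)] at h8
    refine h8.trans (le_of_eq ?_)
    field_simp
  have h10 : 5 * r / K ^ 4 ≤ r / 2 := by
    rw [div_le_div_iff₀ (by positivity) (by norm_num)]
    have : (2 : ℝ) ^ 4 ≤ K ^ 4 := by gcongr
    nlinarith
  calc r ≤ 2 * (P ^ 2 * K ^ 2 * H) := by linarith
    _ ≤ K * (P ^ 2 * K ^ 2 * H) := by gcongr
    _ = _ := by ring

theorem one_le_prod_map {ι : Type*} {R : ι → ℝ} (hR : ∀ i, 1 ≤ R i) (l : List ι) :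
    1 ≤ (l.map R).prod := by
  induction l with
  | nil => simp
  | cons i l ih =>
    rw [List.map_cons, List.prod_cons]
    exact one_le_mul_of_one_le_of_one_le (hR i) ih

/-- One Cauchy–Schwarz step: many differences `h` keep the exponential sum large. -/
theorem card_large_differences {D : ℕ} {K : ℝ} (hK : 2 ≤ K) {R : Fin D → ℝ} (hR1 : ∀ i, 1 ≤ R i)
    {E : Fin D → Finset ℤ} (hE : ∀ i, ∀ m ∈ E i, |(m : ℝ)| ≤ R i) (i : Fin D)
    (p : (Fin D → ℤ) → ℝ)
    (hsum : (∏ i, R i) / K ≤ ‖∑ n ∈ Fintype.piFinset E, expE (p n)‖) :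
    R i ≤ K ^ (4 * D + 3) * ((Finset.Icc (-(⌊2 * R i⌋₊ : ℤ)) ⌊2 * R i⌋₊).filter fun h =>
      (∏ i, R i) / K ^ (2 * D + 6) ≤ ‖∑ n ∈ Fintype.piFinset (shiftInter E i h),
        expE (p (n + Pi.single i h) - p n)‖).card := by
  have hK1 : 1 ≤ K := by linarith
  have hK0 : 0 < K := by linarith
  have hR0 : ∀ i, 0 < R i := fun i => by linarith [hR1 i]
  set ρ : ℝ := ∏ i, R i with hρ
  have hprod : 0 < ρ := Finset.prod_pos fun i _ => hR0 i
  set N := ⌊2 * R i⌋₊ with hN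
  set S : ℤ → ℝ := fun h => ‖∑ n ∈ Fintype.piFinset (shiftInter E i h),
        expE (p (n + Pi.single i h) - p n)‖ with hS
  have hcardE : (0 : ℝ) < (E i).card := by
    rw [Nat.cast_pos, Finset.card_pos, Finset.nonempty_iff_ne_empty]
    intro h0
    have : Fintype.piFinset E = ∅ := by
      rw [Finset.eq_empty_iff_forall_notMem]
      intro n hn
      have := Fintype.mem_piFinset.1 hn i
      simp [h0] at this
    rw [this] at hsum
    have : 0 < ρ / K := by positivity
    simp at hsum
    linarith
  have h1 := card_mul_norm_sum_sq_le E i (fun n => expE (p n))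
  have hEN : ∀ m ∈ E i, 2 * |m| ≤ N := by
    intro m hm
    have : 2 * m.natAbs ≤ N := by
      apply Nat.le_floor
      push_cast
      have := hE i m hm
      rw [Nat.cast_natAbs]
      push_cast
      linarith
    rw [Int.abs_eq_natAbs]
    omega
  rw [sum_sum_update_eq E i N hEN
    (fun n n' => expE (p n) * (starRingEnd ℂ) (expE (p n')))] at h1
  simp only [expE_mul_conj] at h1
  have h2 : ‖∑ h ∈ Finset.Icc (-N : ℤ) N, ∑ n ∈ Fintype.piFinset (shiftInter E i h),
      expE (p (n + Pi.single i h) - p n)‖ ≤ ∑ h ∈ Finset.Icc (-N : ℤ) N, S h := norm_sum_le _ _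
  have h3 := mul_card_piFinset_le hR1 hE i
  have hSle : ∀ h ∈ Finset.Icc (-N : ℤ) N, S h ≤ 3 ^ D * ρ := by
    intro h _
    refine le_trans ?_ (card_piFinset_le (E := shiftInter E i h) hR1
      (fun j m hm => hE j m (shiftInter_subset E i h j hm)))
    refine (norm_sum_le _ _).trans ?_
    simp [norm_expE]
  have hT : 0 ≤ ρ / K ^ (2 * D + 6) := by positivity
  have h4 := sum_le_mul_card_filter_add (Finset.Icc (-N : ℤ) N) S hT hSle
  set H := (Finset.Icc (-N : ℤ) N).filter fun h => ρ / K ^ (2 * D + 6) ≤ S h with hH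
  have h5 : ((Finset.Icc (-N : ℤ) N).card : ℝ) ≤ 5 * R i := by
    have e : (Finset.Icc (-N : ℤ) N).card = 2 * N + 1 := by
      rw [Int.card_Icc]; omega
    rw [e]
    push_cast
    have := Nat.floor_le (show 0 ≤ 2 * R i by linarith [hR0 i])
    linarith [hR1 i]
  have h6 : R i * (ρ / K) ^ 2 ≤ 3 ^ D * ρ * ∑ h ∈ Finset.Icc (-N : ℤ) N, S h := by
    exact mul_sq_le_of_le (hR0 i).le hcardE (by positivity) hsum h1 h2 h3
      (Finset.sum_nonneg fun _ _ => norm_nonneg _) (Nat.cast_nonneg _)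
  have e1 : K ^ (2 * D + 6) = K ^ (2 * D) * K ^ 6 := by rw [pow_add]
  have e2 : K ^ (4 * D + 3) = (K ^ (2 * D)) ^ 2 * K ^ 3 := by ring
  rw [e1] at h4
  rw [e2]
  exact le_of_sq_le_of_card hK (by positivity) hprod (hR0 i).le (by positivity) (three_pow_le hK D)
    (Nat.cast_nonneg _) h6 h4 h5

/-- Induction on the number of directions. Differencing in direction i gives, for many h, a
denominator Q_h for γh. Pigeonholing fixes Q_h = Q₀, and the recurrence lemma applied to Q₀γ removes
h and gains the factor R_i. -/
theorem exists_torusNorm_le_of_hasTop (D m : ℕ) : ∃ C : ℕ, ∀ {K : ℝ}, 2 ≤ K →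
    ∀ {R : Fin D → ℝ}, (∀ i, K ^ C ≤ R i) → ∀ {q : Fin D → ℤ}, (∀ i, 0 < q i) →
    ∀ {E : Fin D → Finset ℤ}, (∀ i, IsStepProg (q i) (E i)) →
    (∀ i, ∀ m ∈ E i, |(m : ℝ)| ≤ R i) → ∀ {l : List (Fin D)}, l.length = m + 1 →
    ∀ {γ : ℝ} {p : (Fin D → ℤ) → ℝ}, HasTop l γ p →
    (∏ i, R i) / K ≤ ‖∑ n ∈ Fintype.piFinset E, expE (p n)‖ →
    ∃ Q : ℕ, 1 ≤ Q ∧ (Q : ℝ) ≤ K ^ C ∧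
      ‖((Q * γ : ℝ) : UnitAddCircle)‖ * (l.map R).prod ≤ K ^ C := by
  induction m with
  | zero =>
    refine ⟨2 * D + 3, ?_⟩
    intro K hK R hR q hq E hqE hE l hl γ p hp hsum
    obtain ⟨i, rfl⟩ := List.length_eq_one_iff.1 hl
    simpa using exists_torusNorm_le_of_hasTop_singleton hK hR hq hqE hE hp hsum
  | succ m ih =>
    obtain ⟨C', ih⟩ := ih
    -- K^a bounds what the induction hypothesis yields at parameter K^(2D+6), and K^(-c) is the
    -- density of the shifts left after pigeonholing. The square of that density costs 2c, and 20
    -- leaves room for numerical constants.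
    set a := (2 * D + 6) * C' with ha
    set c := 4 * D + 4 + a with hc
    refine ⟨2 * c + a + 20, ?_⟩
    intro K hK R hR q hq E hqE hE l hl γ p hp hsum
    obtain ⟨i, l, rfl⟩ := List.exists_cons_of_length_eq_add_one hl
    simp only [List.length_cons, add_left_inj] at hl
    have hK1 : 1 ≤ K := by linarith
    have hK0 : 0 < K := by linarith
    have hR1 : ∀ i, 1 ≤ R i := fun i => (one_le_pow₀ hK1).trans (hR i)
    have hR0 : ∀ i, 0 < R i := fun i => by linarith [hR1 i]
    have hKR : ∀ j (b : ℕ), b ≤ 2 * c + a + 20 → K ^ b ≤ R j := fun j b hb =>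
      (pow_le_pow_right₀ hK1 hb).trans (hR j)
    have hbig := card_large_differences hK hR1 hE i p hsum
    set N := ⌊2 * R i⌋₊ with hN
    set H := (Finset.Icc (-N : ℤ) N).filter fun h =>
      (∏ i, R i) / K ^ (2 * D + 6) ≤ ‖∑ n ∈ Fintype.piFinset (shiftInter E i h),
        expE (p (n + Pi.single i h) - p n)‖ with hH
    set M : ℝ := K ^ a with hM
    have hM0 : 0 < M := by positivity
    have hM1 : 1 ≤ M := one_le_pow₀ hK1
    have hMa : (K ^ (2 * D + 6)) ^ C' = M := by rw [hM, ha, pow_mul]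
    set π := (l.map R).prod with hπ
    -- The remaining list is nonempty, so the product is at least one R_j; this makes the tolerance
    -- M/π small enough for the recurrence lemma.
    have hπ1 : ∃ j, R j ≤ π := by
      obtain ⟨j, l', rfl⟩ := List.exists_cons_of_length_eq_add_one hl
      refine ⟨j, ?_⟩
      rw [hπ, List.map_cons, List.prod_cons]
      have := one_le_prod_map hR1 l'
      nlinarith [hR0 j]
    obtain ⟨j, hj⟩ := hπ1
    have hπ0 : 0 < π := (hR0 j).trans_le hj
    have hQ : ∀ h : ℤ, ∃ Q : ℕ, h ∈ H → 1 ≤ Q ∧ (Q : ℝ) ≤ M ∧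
        ‖((Q * (γ * h) : ℝ) : UnitAddCircle)‖ * π ≤ M := by
      intro h
      by_cases hh : h ∈ H
      · have hh' := (Finset.mem_filter.1 hh).2
        obtain ⟨Q, h1, h2, h3⟩ := ih (K := K ^ (2 * D + 6)) (hK.trans (le_self_pow₀ hK1 (by omega)))
          (R := R) (fun j => by rw [hMa]; exact hKR j a (by omega)) hq (E := shiftInter E i h)
          (fun j => by
            rcases eq_or_ne j i with rfl | hji
            · simpa [shiftInter] using (hqE j).inter_shift h
            · simpa [shiftInter, hji] using hqE j)
          (fun j m hm => hE j m (shiftInter_subset E i h j hm)) hl (hp h) hh'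
        rw [hMa] at h2 h3
        exact ⟨Q, fun _ => ⟨h1, h2, h3⟩⟩
      · exact ⟨0, fun h => absurd h hh⟩
    choose Q hQ using hQ
    -- one denominator `Q₀` serves many differences
    obtain ⟨Q₀, hQ₀, hcard⟩ := Finset.exists_le_card_fiber_of_nsmul_le_card_of_maps_to
      (s := H) (t := Finset.Icc 1 ⌊M⌋₊) (f := Q) (M := ℝ) (b := H.card / M)
      (fun h hh => Finset.mem_Icc.2 ⟨(hQ h hh).1, Nat.le_floor (hQ h hh).2.1⟩)
      (Finset.nonempty_Icc.2 (Nat.le_floor (by simpa using hM1)))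
      (by
        rw [nsmul_eq_mul, Nat.card_Icc, Nat.add_sub_cancel, mul_div_assoc', div_le_iff₀ hM0,
          mul_comm]
        gcongr
        exact Nat.floor_le hM0.le)
    set S := H.filter fun h => Q h = Q₀ with hS
    have hN2 : (N : ℝ) ≤ 2 * R i := Nat.floor_le (by linarith [hR0 i])
    have hN1 : R i ≤ N := by
      have := Nat.lt_floor_add_one (2 * R i)
      linarith [hR1 i]
    set σ : ℝ := (K ^ c)⁻¹ with hσ
    have hσ0 : 0 < σ := by positivity
    have hε : 192 * (M / π) ≤ σ := by
      rw [hσ, ← mul_div_assoc, div_le_iff₀ hπ0, ← div_eq_inv_mul, le_div_iff₀ (by positivity)]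
      calc 192 * M * K ^ c ≤ K ^ 8 * M * K ^ c := by
            gcongr
            exact le_pow_of_le_two_pow hK 8 (by norm_num)
        _ = K ^ (8 + a + c) := by rw [hM]; ring
        _ ≤ R j := hKR j _ (by omega)
        _ ≤ π := hj
    have hσN : 400 ≤ σ ^ 2 * N := by
      rw [hσ, inv_pow, ← div_eq_inv_mul, le_div_iff₀ (by positivity)]
      calc 400 * (K ^ c) ^ 2 ≤ K ^ 9 * (K ^ c) ^ 2 := by
            gcongr
            exact le_pow_of_le_two_pow hK 9 (by norm_num)
        _ = K ^ (9 + c * 2) := by ring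
        _ ≤ R i := hKR i _ (by omega)
        _ ≤ N := hN1
    have hcard' : σ * N ≤ S.card := by
      refine le_trans ?_ hcard
      rw [hσ, ← div_eq_inv_mul, div_le_div_iff₀ (by positivity) hM0]
      have := (hR0 i).le
      calc N * M ≤ (K * (K ^ (4 * D + 3) * H.card)) * M := by
            gcongr
            exact hN2.trans (by gcongr)
        _ = H.card * K ^ c := by rw [hc, hM]; ring
    obtain ⟨t, ht1, ht2, ht3⟩ := exists_torusNorm_le_of_card (γ := Q₀ * γ) (S := S) hσ0
      (inv_le_one_of_one_le₀ (one_le_pow₀ hK1)) hσN (by positivity) hε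
      (fun h hh => (Finset.mem_filter.1 (Finset.mem_filter.1 hh).1).1) hcard' (by
        intro h hh
        obtain ⟨h1, h2⟩ := Finset.mem_filter.1 hh
        have := (hQ h h1).2.2
        rw [le_div_iff₀ hπ0]
        rwa [h2, ← mul_assoc] at this)
    obtain ⟨hQ₁, hQ₂⟩ := Finset.mem_Icc.1 hQ₀
    have hQM : (Q₀ : ℝ) ≤ M := (Nat.cast_le.2 hQ₂).trans (Nat.floor_le hM0.le)
    refine ⟨t * Q₀, Nat.mul_pos ht1 hQ₁, ?_, ?_⟩
    · push_cast
      rw [hσ, ← div_eq_mul_inv, div_le_iff₀ (by positivity)] at ht2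
      calc (t : ℝ) * Q₀ ≤ 100 * K ^ c * M := by gcongr
        _ ≤ K ^ 7 * K ^ c * M := by
            gcongr
            exact le_pow_of_le_two_pow hK 7 (by norm_num)
        _ = K ^ (7 + c + a) := by rw [hM]; ring
        _ ≤ _ := pow_le_pow_right₀ hK1 (by omega)
    · rw [List.map_cons, List.prod_cons, ← hπ]
      push_cast
      rw [mul_assoc (t : ℝ)]
      set τ := ‖((t * (Q₀ * γ) : ℝ) : UnitAddCircle)‖
      have hτ : 0 ≤ τ := norm_nonneg _
      rw [hσ, inv_pow, ← div_eq_inv_mul, ← mul_div_assoc, div_le_iff₀ (by positivity),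
        ← mul_div_assoc, div_mul_eq_mul_div, le_div_iff₀ hπ0] at ht3
      calc τ * (R i * π) ≤ τ * N * π := by rw [← mul_assoc]; gcongr
        _ ≤ 800 * M * (K ^ c) ^ 2 := ht3
        _ ≤ K ^ 10 * M * (K ^ c) ^ 2 := by
            gcongr
            exact le_pow_of_le_two_pow hK 10 (by norm_num)
        _ = K ^ (10 + a + c * 2) := by rw [hM]; ring
        _ ≤ _ := pow_le_pow_right₀ hK1 (by omega)

/-! ### Extracting a top coefficient by differencing -/

theorem HasTop.zero {D : ℕ} (l : List (Fin D)) : HasTop l 0 (fun _ => 0) := by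
  induction l with
  | nil => exact fun _ => rfl
  | cons i l ih => intro h; simpa using ih

theorem HasTop.add {D : ℕ} {l : List (Fin D)} {γ γ' : ℝ} {p p' : (Fin D → ℤ) → ℝ}
    (h : HasTop l γ p) (h' : HasTop l γ' p') : HasTop l (γ + γ') (fun n => p n + p' n) := by
  induction l generalizing γ γ' p p' with
  | nil => exact fun n => by beta_reduce; rw [h n, h' n]
  | cons i l ih =>
    intro t
    convert ih (h t) (h' t) using 1
    · ring
    · ext n; ring

theorem HasTop.const_mul {D : ℕ} {l : List (Fin D)} {γ : ℝ} {p : (Fin D → ℤ) → ℝ}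
    (h : HasTop l γ p) (c : ℝ) : HasTop l (c * γ) (fun n => c * p n) := by
  induction l generalizing γ p with
  | nil => exact fun n => by beta_reduce; rw [h n]
  | cons i l ih =>
    intro t
    convert ih (h t) using 1
    · ring
    · ext n; ring

theorem HasTop.sum {D : ℕ} {ι : Type*} {l : List (Fin D)} (s : Finset ι) {γ : ι → ℝ}
    {p : ι → (Fin D → ℤ) → ℝ} (h : ∀ a ∈ s, HasTop l (γ a) (p a)) :
    HasTop l (∑ a ∈ s, γ a) (fun n => ∑ a ∈ s, p a n) := by
  classical
  induction s using Finset.induction_on with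
  | empty => simpa using HasTop.zero l
  | insert a s ha ih =>
    simp only [Finset.sum_insert ha]
    exact (h a (Finset.mem_insert_self a s)).add (ih fun b hb => h b (Finset.mem_insert_of_mem hb))

open Finset in
theorem prod_pow_shift_sub {D : ℕ} (β : Fin D → ℕ) (i : Fin D) (h : ℤ) (n : Fin D → ℤ) :
    ∏ j, (((n + (Pi.single i h : Fin D → ℤ)) j : ℤ) : ℝ) ^ β j - ∏ j, (n j : ℝ) ^ β j
      = ∑ k ∈ range (β i), ((β i).choose k * (h : ℝ) ^ (β i - k)) *
        ∏ j, (n j : ℝ) ^ Function.update β i k j := by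
  have e1 : ∀ f : Fin D → ℝ, ∏ j, f j = f i * ∏ j ∈ univ.erase i, f j := fun f =>
    (mul_prod_erase _ _ (mem_univ i)).symm
  have e2 : ∀ k, ∏ j ∈ univ.erase i, (n j : ℝ) ^ Function.update β i k j
      = ∏ j ∈ univ.erase i, (n j : ℝ) ^ β j := fun k => prod_congr rfl fun j hj => by
    simp [ne_of_mem_erase hj]
  have e3 : ∏ j ∈ univ.erase i, (((n + (Pi.single i h : Fin D → ℤ)) j : ℤ) : ℝ) ^ β j
      = ∏ j ∈ univ.erase i, (n j : ℝ) ^ β j := prod_congr rfl fun j hj => by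
    simp [ne_of_mem_erase hj]
  simp_rw [e1, e2, e3, Function.update_self]
  rw [← sub_mul]
  simp_rw [← mul_assoc]
  rw [← sum_mul]
  congr 1
  simp only [Pi.add_apply, Pi.single_eq_same]
  push_cast
  rw [add_pow, sum_range_succ]
  simp only [tsub_self, pow_zero, mul_one, Nat.choose_self, Nat.cast_one, add_sub_cancel_right]
  exact sum_congr rfl fun k _ => by ring

theorem sum_count_eq_length {D : ℕ} (l : List (Fin D)) : ∑ j, l.count j = l.length := by
  simpa using Multiset.sum_count_eq_card (s := Finset.univ) (m := (l : Multiset (Fin D))) (by simp)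

open Finset in
-- Each difference expands binomially and lowers the exponent of its variable by at least one. For
-- degree at most the length of the list, something survives only if every step lowers it by exactly
-- one in a prescribed variable; the binomial factors then multiply to α!.
theorem HasTop.prod_pow {D : ℕ} (l : List (Fin D)) (β : Fin D → ℕ) (hβ : ∑ j, β j ≤ l.length) :
    HasTop l (if β = fun j => l.count j then ((∏ j, (β j).factorial : ℕ) : ℝ) else 0)
      (fun n => ∏ j, (n j : ℝ) ^ β j) := by
  induction l generalizing β with
  | nil =>
    intro n
    have h0 : ∀ j, β j = 0 := by simpa using hβ
    have : β = fun j => ([] : List (Fin D)).count j := by ext j; simp [h0 j]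
    rw [if_pos this]
    simp [h0]
  | cons i l ih =>
    intro h
    simp only [prod_pow_shift_sub]
    have hsum : ∀ k, ∑ j, Function.update β i k j + β i = ∑ j, β j + k := by
      intro k
      rw [← add_sum_erase _ _ (mem_univ i), ← add_sum_erase _ β (mem_univ i), Function.update_self]
      have : ∑ j ∈ univ.erase i, Function.update β i k j = ∑ j ∈ univ.erase i, β j :=
        sum_congr rfl fun j hj => by simp [ne_of_mem_erase hj]
      omega
    rw [List.length_cons] at hβ
    have key := HasTop.sum (l := l) (range (β i)) (fun k hk => (ih (Function.update β i k) (by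
      have := hsum k
      have := mem_range.1 hk
      omega)).const_mul ((β i).choose k * (h : ℝ) ^ (β i - k)))
    convert key using 1
    by_cases hβl : β = fun j => (i :: l).count j
    · rw [if_pos hβl]
      have hi : β i = l.count i + 1 := by rw [hβl]; simp
      have hu : Function.update β i (l.count i) = fun j => l.count j := by
        ext j
        rcases eq_or_ne j i with rfl | hj
        · simp
        · rw [Function.update_of_ne hj, hβl]
          simp [List.count_cons_of_ne hj.symm]
      rw [sum_eq_single (l.count i)]
      · rw [if_pos hu, hi, ← mul_prod_erase _ _ (mem_univ i), hi,
          ← mul_prod_erase _ _ (mem_univ i), Function.update_self]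
        have : ∏ j ∈ univ.erase i, (Function.update β i (l.count i) j).factorial
            = ∏ j ∈ univ.erase i, (β j).factorial := prod_congr rfl fun j hj => by
          simp [ne_of_mem_erase hj]
        rw [this, Nat.factorial_succ]
        simp
        ring
      · intro k _ hk
        rw [if_neg, mul_zero]
        intro hu'
        apply hk
        simpa using congrFun hu' i
      · intro hk
        exact absurd (mem_range.2 (by omega)) hk
    · rw [if_neg hβl, zero_mul]
      refine (sum_eq_zero fun k hk => ?_).symm
      rw [if_neg, mul_zero]
      intro hu
      apply hβl
      -- A surviving term with k < β_i forces k = β_i - 1 by counting degrees, and then β would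
      -- match the whole list.
      have h1 := hsum k
      rw [hu, sum_count_eq_length] at h1
      have hk' := mem_range.1 hk
      have hki : k = l.count i := by simpa using congrFun hu i
      ext j
      rcases eq_or_ne j i with rfl | hj
      · simp; omega
      · have := congrFun hu j
        rw [Function.update_of_ne hj] at this
        simp [List.count_cons_of_ne hj.symm, this]

/-- The value at `n` of the polynomial of degree at most `d` with coefficients `c`. -/
noncomputable def polyVal {D : ℕ} (d : ℕ) (c : (Fin D →₀ ℕ) → ℝ) (n : Fin D → ℤ) : ℝ :=
  ∑ m ∈ Finset.range (d + 1), ∑ α ∈ Finset.finsuppAntidiag Finset.univ m,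
    c α * ∏ j, (n j : ℝ) ^ α j

/-- A list of directions in which `j` occurs `α j` times. -/
theorem exists_list_count {D : ℕ} (α : Fin D →₀ ℕ) :
    ∃ l : List (Fin D), (∀ j, l.count j = α j) ∧ ∀ R : Fin D → ℝ,
      (l.map R).prod = ∏ j, R j ^ α j := by
  have hc : ∀ j, (Finsupp.toMultiset α).toList.count j = α j := fun j => by
    rw [← Multiset.coe_count, Multiset.coe_toList, Finsupp.count_toMultiset]
  refine ⟨(Finsupp.toMultiset α).toList, hc, fun R => ?_⟩
  rw [Finset.prod_list_map_count]
  refine (Finset.prod_subset (Finset.subset_univ _) fun j _ hj => ?_).trans ?_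
  · rw [List.mem_toFinset, ← List.count_eq_zero] at hj
    rw [hj, pow_zero]
  · simp_rw [hc]

open Finset in
theorem hasTop_polyVal {D : ℕ} (d : ℕ) (c : (Fin D →₀ ℕ) → ℝ) {l : List (Fin D)}
    {α : Fin D →₀ ℕ} (hl : ∀ j, l.count j = α j) (hα : ∑ j, α j = d) :
    HasTop l (c α * ((∏ j, (α j).factorial : ℕ) : ℝ)) (polyVal d c) := by
  have hlen : l.length = d := by rw [← sum_count_eq_length, ← hα]; simp [hl]
  have key := HasTop.sum (l := l) (range (d + 1)) (fun m hm =>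
    HasTop.sum (finsuppAntidiag univ m) (fun β hβ =>
      (HasTop.prod_pow l β (by
        have h1 : ∑ j, β j = m := (mem_finsuppAntidiag.1 hβ).1
        have := mem_range.1 hm
        omega)).const_mul (c β)))
  convert key using 1
  swap
  · rfl
  have hiff : ∀ β : Fin D →₀ ℕ, ((β : Fin D → ℕ) = fun j => l.count j) ↔ β = α := by
    intro β
    simp_rw [hl]
    exact ⟨fun h => DFunLike.coe_injective h, fun h => by rw [h]⟩
  simp_rw [hiff]
  rw [sum_eq_single d, sum_eq_single α]
  · simp
  · intro β _ hβ
    simp [hβ]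
  · intro h
    exact absurd (mem_finsuppAntidiag.2 ⟨hα, subset_univ _⟩) h
  · intro m _ hm
    refine sum_eq_zero fun β hβ => ?_
    rw [if_neg, mul_zero]
    rintro rfl
    exact hm ((mem_finsuppAntidiag.1 hβ).1.symm.trans hα)
  · intro h
    exact absurd (mem_range.2 (by omega)) h

/-! ### Localization to sub-boxes -/

theorem abs_mul_sub_mul_le {u v u' v' U U' c c' : ℝ} (hu : |u| ≤ U) (hv' : |v'| ≤ U')
    (h : |u - v| ≤ c * U) (h' : |u' - v'| ≤ c' * U') : |u * u' - v * v'| ≤ (c + c') * (U * U') := by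
  have hU : 0 ≤ U := (abs_nonneg _).trans hu
  have hU' : 0 ≤ U' := (abs_nonneg _).trans hv'
  calc |u * u' - v * v'| = |u * (u' - v') + (u - v) * v'| := by ring_nf
    _ ≤ |u| * |u' - v'| + |u - v| * |v'| := by
      rw [← abs_mul, ← abs_mul]
      exact abs_add_le _ _
    _ ≤ U * (c' * U') + (c * U) * U' := by
      gcongr
      exact (abs_nonneg _).trans h
    _ = _ := by ring

theorem abs_prod_pow_le {D : ℕ} {R x : Fin D → ℝ} (hx : ∀ j, |x j| ≤ R j) (α : Fin D → ℕ)
    (s : Finset (Fin D)) : |∏ j ∈ s, x j ^ α j| ≤ ∏ j ∈ s, R j ^ α j := by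
  rw [Finset.abs_prod]
  gcongr with j
  rw [abs_pow]
  gcongr
  exact hx j

/-- By the Leibniz rule, relative errors add over the factors of a monomial, so its degree is the
Lipschitz constant at scale R. -/
theorem abs_prod_pow_sub_le {D : ℕ} {R x y : Fin D → ℝ} {c : ℝ} (hx : ∀ j, |x j| ≤ R j)
    (hy : ∀ j, |y j| ≤ R j) (hxy : ∀ j, |x j - y j| ≤ c * R j) (α : Fin D → ℕ)
    (s : Finset (Fin D)) :
    |∏ j ∈ s, x j ^ α j - ∏ j ∈ s, y j ^ α j| ≤ ((∑ j ∈ s, α j : ℕ) * c) * ∏ j ∈ s, R j ^ α j := by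
  have hpow : ∀ j (a : ℕ), |x j ^ a - y j ^ a| ≤ (a * c) * R j ^ a := by
    intro j a
    induction a with
    | zero => simp
    | succ a ih =>
      rw [pow_succ, pow_succ, pow_succ]
      have := abs_mul_sub_mul_le (by rw [abs_pow]; gcongr; exact hx j) (hy j) ih (hxy j)
      refine this.trans (le_of_eq ?_)
      push_cast
      ring
  induction s using Finset.induction_on with
  | empty => simp
  | insert i s hi ih =>
    rw [Finset.prod_insert hi, Finset.prod_insert hi, Finset.prod_insert hi, Finset.sum_insert hi]
    have := abs_mul_sub_mul_le (by rw [abs_pow]; gcongr; exact hx i)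
      (abs_prod_pow_le hy α s) (hpow i (α i)) ih
    refine this.trans (le_of_eq ?_)
    push_cast
    ring

theorem dvd_prod_pow_sub {D : ℕ} {M : ℕ} {x y : Fin D → ℤ} (h : ∀ j, (M : ℤ) ∣ x j - y j)
    (α : Fin D → ℕ) : (M : ℤ) ∣ ∏ j, x j ^ α j - ∏ j, y j ^ α j := by
  rw [← ZMod.intCast_eq_intCast_iff_dvd_sub]
  push_cast
  refine Finset.prod_congr rfl fun j _ => ?_
  rw [(ZMod.intCast_eq_intCast_iff_dvd_sub (y j) (x j) M).2 (h j)]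

open Finset in
/-- If `G` is almost constant on the pieces into which residues modulo `M` and cells of relative
size `1 / J` cut a box, then the factor `G` can be removed from a large sum on some piece. -/
theorem exists_subbox {D : ℕ} {K : ℝ} (hK : 0 < K) {R : Fin D → ℝ} (hR1 : ∀ i, 1 ≤ R i)
    {q : Fin D → ℤ} (hq : ∀ i, 0 < q i) {E : Fin D → Finset ℤ} (hqE : ∀ i, IsStepProg (q i) (E i))
    (hE : ∀ i, ∀ m ∈ E i, |(m : ℝ)| ≤ R i) {M J : ℕ} (hM : 1 ≤ M) (hJ : 1 ≤ J)
    {F G : (Fin D → ℤ) → ℂ} (hF : ∀ n, ‖F n‖ ≤ 1) (hG : ∀ n, ‖G n‖ ≤ 1)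
    (hFG : ∀ n ∈ Fintype.piFinset E, ∀ n' ∈ Fintype.piFinset E, (∀ i, (M : ℤ) ∣ n i - n' i) →
      (∀ i, |(n i : ℝ) - n' i| ≤ R i / J) → ‖G n - G n'‖ ≤ 1 / (2 * 3 ^ D * K))
    (hsum : (∏ i, R i) / K ≤ ‖∑ n ∈ Fintype.piFinset E, F n * G n‖) :
    ∃ q' : Fin D → ℤ, (∀ i, 0 < q' i) ∧ ∃ E' : Fin D → Finset ℤ,
      (∀ i, IsStepProg (q' i) (E' i)) ∧ (∀ i, E' i ⊆ E i) ∧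
      (∏ i, R i) / (4 * K * (M * (2 * J + 1)) ^ D) ≤ ‖∑ n ∈ Fintype.piFinset E', F n‖ := by
  have hR0 : ∀ i, 0 < R i := fun i => by linarith [hR1 i]
  set ρ : ℝ := ∏ i, R i with hρ
  have hρ0 : 0 < ρ := prod_pos fun i _ => hR0 i
  have hM0 : (0 : ℤ) < M := by exact_mod_cast hM
  have hJ0 : (0 : ℝ) < J := by exact_mod_cast hJ
  -- A coordinate is classified by its residue and its cell of length R_i/J. Since mJ/R_i lies in
  -- [-J, J] with both ends possible, there are 2J + 1 cells.
  set key : Fin D → ℤ → ℤ × ℤ := fun i m => (m % M, ⌊m * J / R i⌋) with hkey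
  set keys : Finset (Fin D → ℤ × ℤ) :=
    Fintype.piFinset fun _ => Ico (0 : ℤ) M ×ˢ Icc (-J : ℤ) J with hkeys
  have hcard : (keys.card : ℝ) = (M * (2 * J + 1)) ^ D := by
    rw [hkeys, Fintype.card_piFinset]
    simp only [card_product, Int.card_Ico, Int.card_Icc, prod_const, card_univ, Fintype.card_fin]
    have e1 : ((M : ℤ) - 0).toNat = M := by omega
    have e2 : ((J : ℤ) + 1 - -J).toNat = 2 * J + 1 := by omega
    rw [e1, e2]
    push_cast
    ring
  have hcard0 : (0 : ℝ) < keys.card := by rw [hcard]; positivity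
  set fib : (Fin D → ℤ × ℤ) → Fin D → Finset ℤ := fun k i => (E i).filter fun m => key i m = k i
    with hfib
  have hfibE : ∀ k i, fib k i ⊆ E i := fun k i => filter_subset _ _
  have hmaps : ∀ n ∈ Fintype.piFinset E, (fun i => key i (n i)) ∈ keys := by
    intro n hn
    rw [hkeys, Fintype.mem_piFinset]
    intro i
    have h1 := abs_le.1 (hE i _ (Fintype.mem_piFinset.1 hn i))
    simp only [hkey, mem_product, mem_Ico, mem_Icc]
    refine ⟨⟨Int.emod_nonneg _ hM0.ne', Int.emod_lt_of_pos _ hM0⟩, ?_, ?_⟩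
    · rw [Int.le_floor, le_div_iff₀ (hR0 i)]
      push_cast
      nlinarith
    · rw [← Int.lt_add_one_iff, Int.floor_lt, div_lt_iff₀ (hR0 i)]
      push_cast
      nlinarith [hR0 i]
  have hfilter : ∀ k, (Fintype.piFinset E).filter (fun n => (fun i => key i (n i)) = k)
      = Fintype.piFinset (fib k) := by
    intro k
    ext n
    simp only [mem_filter, Fintype.mem_piFinset, hfib, funext_iff, forall_and]
  have hsplit : ∑ n ∈ Fintype.piFinset E, F n * G n
      = ∑ k ∈ keys, ∑ n ∈ Fintype.piFinset (fib k), F n * G n := by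
    rw [← sum_fiberwise_of_maps_to hmaps]
    simp_rw [hfilter]
  have hsplit' : ∑ k ∈ keys, ((Fintype.piFinset (fib k)).card : ℝ) = (Fintype.piFinset E).card := by
    rw [card_eq_sum_card_fiberwise hmaps]
    simp_rw [hfilter]
    push_cast
    rfl
  -- If all pieces were below T, they would contribute at most ρ/(4K) in total and the variation of
  -- G at most ρ/(2K), which is less than ρ/K.
  set T : ℝ := ρ / (4 * K * (M * (2 * J + 1)) ^ D) with hT
  have hT0 : 0 ≤ T := by positivity
  obtain ⟨k, hk, hkT⟩ : ∃ k ∈ keys, T ≤ ‖∑ n ∈ Fintype.piFinset (fib k), F n‖ := by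
    by_contra! hcon
    have hpiece : ∀ k ∈ keys, ‖∑ n ∈ Fintype.piFinset (fib k), F n * G n‖
        ≤ T + (Fintype.piFinset (fib k)).card * (1 / (2 * 3 ^ D * K)) := by
      intro k hk
      rcases (Fintype.piFinset (fib k)).eq_empty_or_nonempty with h0 | ⟨x, hx⟩
      · rw [h0]; simpa using hT0
      have e : ∑ n ∈ Fintype.piFinset (fib k), F n * G n
          = (∑ n ∈ Fintype.piFinset (fib k), F n) * G x
            + ∑ n ∈ Fintype.piFinset (fib k), F n * (G n - G x) := by
        rw [sum_mul, ← sum_add_distrib]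
        exact sum_congr rfl fun n _ => by ring
      rw [e]
      refine (norm_add_le _ _).trans (add_le_add ?_ ?_)
      · rw [norm_mul]
        have := hG x
        have := (hcon k hk).le
        have := norm_nonneg (∑ n ∈ Fintype.piFinset (fib k), F n)
        nlinarith
      · rw [← nsmul_eq_mul]
        refine (norm_sum_le _ _).trans (sum_le_card_nsmul _ _ _ fun n hn => ?_)
        have hsub := Fintype.piFinset_subset _ _ (hfibE k)
        have hkk : ∀ i, key i (n i) = key i (x i) := fun i =>
          (mem_filter.1 (Fintype.mem_piFinset.1 hn i)).2.trans
            (mem_filter.1 (Fintype.mem_piFinset.1 hx i)).2.symm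
        have h1 := hFG n (hsub hn) x (hsub hx)
          (fun i => Int.ModEq.dvd (show x i % M = n i % M from (congrArg Prod.fst (hkk i)).symm))
          (fun i => by
            have h2 : ⌊(n i : ℝ) * J / R i⌋ = ⌊(x i : ℝ) * J / R i⌋ := congrArg Prod.snd (hkk i)
            have h3 := (Int.abs_sub_lt_one_of_floor_eq_floor h2).le
            rw [← sub_div, ← sub_mul, abs_div, abs_mul, abs_of_pos hJ0, abs_of_pos (hR0 i),
              div_le_one (hR0 i)] at h3
            rwa [le_div_iff₀ hJ0])
        rw [norm_mul]
        have := hF n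
        nlinarith [norm_nonneg (F n), norm_nonneg (G n - G x)]
    have h1 : ‖∑ n ∈ Fintype.piFinset E, F n * G n‖
        ≤ keys.card * T + (Fintype.piFinset E).card * (1 / (2 * 3 ^ D * K)) := by
      rw [hsplit, ← hsplit', sum_mul]
      refine (norm_sum_le _ _).trans ((sum_le_sum hpiece).trans (le_of_eq ?_))
      rw [sum_add_distrib, sum_const, nsmul_eq_mul]
    have h2 : ((Fintype.piFinset E).card : ℝ) * (1 / (2 * 3 ^ D * K)) ≤ ρ / K / 2 := by
      calc _ ≤ (3 ^ D * ρ) * (1 / (2 * 3 ^ D * K)) := by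
            gcongr
            exact card_piFinset_le hR1 hE
        _ = _ := by field_simp
    have h3 : keys.card * T = ρ / K / 4 := by
      rw [hT, ← hcard]
      field_simp
    have h4 : 0 < ρ / K := by positivity
    linarith
  refine ⟨fun i => lcm (q i) M, fun i => ?_, fib k, fun i => ?_, hfibE k, hkT⟩
  · have h0 : lcm (q i) (M : ℤ) ≠ 0 := by
      rw [Ne, _root_.lcm_eq_zero_iff]
      have := hq i
      omega
    have h1 : 0 ≤ lcm (q i) (M : ℤ) := by
      rw [← Int.coe_lcm]
      exact Int.natCast_nonneg _
    exact lt_of_le_of_ne h1 h0.symm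
  · rw [hkeys, Fintype.mem_piFinset] at hk
    have hki := hk i
    simp only [mem_product, mem_Ico] at hki
    -- The cells are half-open on the right, so the last integer of a cell is a ceiling minus one.
    have := (hqE i).inter_residue M (k i).1 ⌈(k i).2 * R i / J⌉ (⌈((k i).2 + 1) * R i / J⌉ - 1)
    convert this using 1
    refine filter_congr fun m _ => ?_
    simp only [hkey, Prod.ext_iff]
    have e1 : m % M = (k i).1 ↔ (M : ℤ) ∣ m - (k i).1 := by
      rw [Int.emod_eq_iff hM0.ne', ← dvd_neg, neg_sub]
      have := hki.1
      constructor
      · exact fun h => h.2.2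
      · exact fun h => ⟨this.1, by simpa using this.2, h⟩
    have e2 : ⌊(m : ℝ) * J / R i⌋ = (k i).2 ↔
        ⌈(k i).2 * R i / J⌉ ≤ m ∧ m ≤ ⌈((k i).2 + 1) * R i / J⌉ - 1 := by
      rw [Int.floor_eq_iff, Int.ceil_le, Int.le_sub_one_iff, Int.lt_ceil, le_div_iff₀ (hR0 i),
        div_lt_iff₀ (hR0 i), div_le_iff₀ hJ0, lt_div_iff₀ hJ0]
    rw [e1, e2]
    tauto

/-! ### The inverse theorem by induction on the degree -/

theorem polyVal_succ {D : ℕ} (d : ℕ) (c : (Fin D →₀ ℕ) → ℝ) (n : Fin D → ℤ) :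
    polyVal (d + 1) c n = polyVal d c n +
      ∑ α ∈ Finset.finsuppAntidiag Finset.univ (d + 1), c α * ∏ j, (n j : ℝ) ^ α j :=
  Finset.sum_range_succ _ _

theorem sum_eq_of_mem_finsuppAntidiag {D m : ℕ} {α : Fin D →₀ ℕ}
    (h : α ∈ Finset.finsuppAntidiag Finset.univ m) : ∑ j, α j = m :=
  (Finset.mem_finsuppAntidiag.1 h).1

theorem mem_finsuppAntidiag_univ {D : ℕ} (α : Fin D →₀ ℕ) :
    α ∈ Finset.finsuppAntidiag Finset.univ (∑ j, α j) :=
  Finset.mem_finsuppAntidiag.2 ⟨rfl, Finset.subset_univ _⟩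

/-- The two monomial values differ by Mz with z an integer, so the phase difference is z(Mc). Thus
its distance to the integers is at most |z| ‖Mc‖, and |z| ≤ |Mz| is bounded by the Lipschitz
estimate. -/
theorem torusNorm_mul_mul_prod_le {D M : ℕ} (hM : 1 ≤ M) {R : Fin D → ℝ}
    {J : ℕ} (c : ℝ) (α : Fin D → ℕ) {x y : Fin D → ℤ} (hx : ∀ j, |(x j : ℝ)| ≤ R j)
    (hy : ∀ j, |(y j : ℝ)| ≤ R j) (hxy : ∀ j, |(x j : ℝ) - y j| ≤ R j / J)
    (hd : ∀ j, (M : ℤ) ∣ x j - y j) :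
    ‖((c * ∏ j, (x j : ℝ) ^ α j - c * ∏ j, (y j : ℝ) ^ α j : ℝ) : UnitAddCircle)‖
      ≤ (∑ j, α j : ℕ) * (‖((M * c : ℝ) : UnitAddCircle)‖ * ∏ j, R j ^ α j) / J := by
  obtain ⟨z, hz⟩ := dvd_prod_pow_sub hd α
  have hz' : ∏ j, (x j : ℝ) ^ α j - ∏ j, (y j : ℝ) ^ α j = M * z := by exact_mod_cast hz
  have h1 := abs_prod_pow_sub_le (c := 1 / (J : ℝ)) hx hy
    (fun j => by rw [one_div_mul_eq_div]; exact hxy j) α Finset.univ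
  have hM' : (1 : ℝ) ≤ M := by exact_mod_cast hM
  have hzabs : |(z : ℝ)| ≤ |(M : ℝ) * z| := by
    rw [abs_mul, Nat.abs_cast]
    nlinarith [abs_nonneg (z : ℝ)]
  rw [← mul_sub, hz', show c * (M * z) = z * (M * c) by ring]
  refine (torusNorm_intCast_mul_le _ _).trans ?_
  rw [hz'] at h1
  calc _ ≤ ((∑ j, α j : ℕ) * (1 / (J : ℝ)) * ∏ j, R j ^ α j) * ‖((M * c : ℝ) : UnitAddCircle)‖ := by
        gcongr
        exact hzabs.trans h1
    _ = _ := by ring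

open Finset in
-- Each top coefficient has its own denominator, with α! absorbed. Their product serves all at once,
-- since the number of multi-indices depends only on D and d.
theorem exists_common_top_denominator (D d : ℕ) : ∃ C : ℕ, ∀ {K : ℝ}, 2 ≤ K →
    ∀ {R : Fin D → ℝ}, (∀ i, K ^ C ≤ R i) → ∀ {q : Fin D → ℤ}, (∀ i, 0 < q i) →
    ∀ {E : Fin D → Finset ℤ}, (∀ i, IsStepProg (q i) (E i)) →
    (∀ i, ∀ m ∈ E i, |(m : ℝ)| ≤ R i) → ∀ {c : (Fin D →₀ ℕ) → ℝ},
    (∏ i, R i) / K ≤ ‖∑ n ∈ Fintype.piFinset E, expE (polyVal (d + 1) c n)‖ →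
    ∃ M : ℕ, 1 ≤ M ∧ (M : ℝ) ≤ K ^ C ∧ ∀ α ∈ finsuppAntidiag univ (d + 1),
      ‖((M * c α : ℝ) : UnitAddCircle)‖ * ∏ j, R j ^ α j ≤ K ^ C := by
  classical
  obtain ⟨C, hC⟩ := exists_torusNorm_le_of_hasTop D d
  set A := (finsuppAntidiag (univ : Finset (Fin D)) (d + 1)).card with hA
  set b := C + (d + 1).factorial with hb
  refine ⟨b * A + b, ?_⟩
  intro K hK R hR q hq E hqE hE c hsum
  have hK1 : 1 ≤ K := by linarith
  have hK0 : 0 < K := by linarith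
  have hR0 : ∀ i, 0 ≤ R i := fun i => (by positivity : 0 ≤ K ^ (b * A + b)).trans (hR i)
  have hQ : ∀ α : Fin D →₀ ℕ, ∃ Q : ℕ, α ∈ finsuppAntidiag univ (d + 1) → 1 ≤ Q ∧ (Q : ℝ) ≤ K ^ b ∧
      ‖((Q * c α : ℝ) : UnitAddCircle)‖ * ∏ j, R j ^ α j ≤ K ^ b := by
    intro α
    by_cases hα : α ∈ finsuppAntidiag univ (d + 1)
    swap
    · exact ⟨0, fun h => absurd h hα⟩
    have hαd := sum_eq_of_mem_finsuppAntidiag hα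
    obtain ⟨l, hl, hlR⟩ := exists_list_count α
    obtain ⟨Q, h1, h2, h3⟩ := hC hK
      (fun i => (pow_le_pow_right₀ hK1 (by rw [hb]; omega)).trans (hR i)) hq hqE hE
      (by rw [← sum_count_eq_length, ← hαd]; simp [hl]) (hasTop_polyVal (d + 1) c hl hαd) hsum
    have hf0 : 0 < ∏ j, (α j).factorial := prod_pos fun j _ => Nat.factorial_pos _
    have hf1 : ∏ j, (α j).factorial ≤ (d + 1).factorial := by
      rw [← hαd]
      exact Nat.le_of_dvd (Nat.factorial_pos _) (Nat.prod_factorial_dvd_factorial_sum _ _)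
    refine ⟨Q * ∏ j, (α j).factorial, fun _ => ⟨Nat.mul_pos h1 hf0, ?_, ?_⟩⟩
    · rw [Nat.cast_mul, hb, pow_add]
      gcongr
      refine (Nat.cast_le.2 hf1).trans (le_pow_of_le_two_pow hK _ ?_)
      exact_mod_cast Nat.lt_two_pow_self.le
    · rw [hlR] at h3
      rw [Nat.cast_mul, mul_assoc, mul_comm _ (c α)]
      exact h3.trans (pow_le_pow_right₀ hK1 (by omega))
  choose Q hQ using hQ
  set T := finsuppAntidiag (univ : Finset (Fin D)) (d + 1) with hT
  have hprod : ∀ T' ⊆ T, 1 ≤ ∏ α ∈ T', Q α ∧ ((∏ α ∈ T', Q α : ℕ) : ℝ) ≤ K ^ (b * A) := by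
    intro T' hT'
    refine ⟨Nat.one_le_iff_ne_zero.2 (prod_ne_zero_iff.2 fun α hα => ?_), ?_⟩
    · have := (hQ α (hT' hα)).1
      omega
    · push_cast
      calc ∏ α ∈ T', (Q α : ℝ) ≤ ∏ α ∈ T', K ^ b := by
            gcongr with α hα
            exact (hQ α (hT' hα)).2.1
        _ = K ^ (b * T'.card) := by rw [prod_const, pow_mul]
        _ ≤ _ := pow_le_pow_right₀ hK1 (Nat.mul_le_mul_left _ (card_le_card hT'))
  refine ⟨∏ α ∈ T, Q α, (hprod T Subset.rfl).1,
    (hprod T Subset.rfl).2.trans (pow_le_pow_right₀ hK1 (by omega)), fun α hα => ?_⟩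
  have hR' : 0 ≤ ∏ j, R j ^ α j := prod_nonneg fun j _ => pow_nonneg (hR0 j) _
  rw [← mul_prod_erase _ _ hα, Nat.cast_mul, mul_comm (Q α : ℝ), mul_assoc]
  calc _ ≤ ((∏ β ∈ T.erase α, Q β : ℕ) : ℝ) * ‖((Q α * c α : ℝ) : UnitAddCircle)‖
          * ∏ j, R j ^ α j := by
        gcongr
        exact torusNorm_natCast_mul_le _ _
    _ = ((∏ β ∈ T.erase α, Q β : ℕ) : ℝ) * (‖((Q α * c α : ℝ) : UnitAddCircle)‖
          * ∏ j, R j ^ α j) := by ring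
    _ ≤ K ^ (b * A) * K ^ b := by
        gcongr
        · exact (hprod _ (erase_subset _ _)).2
        · exact (hQ α hα).2.2
    _ = _ := (pow_add _ _ _).symm

theorem exists_nat_between_pow {K : ℝ} (hK : 2 ≤ K) (g : ℕ) :
    ∃ J : ℕ, 1 ≤ J ∧ K ^ g ≤ J ∧ (2 * J + 1 : ℝ) ≤ K ^ (g + 3) := by
  have hg : 1 ≤ K ^ g := one_le_pow₀ (by linarith)
  refine ⟨⌈K ^ g⌉₊, Nat.one_le_iff_ne_zero.2 (Nat.ceil_pos.2 (by linarith)).ne', Nat.le_ceil _, ?_⟩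
  have := (Nat.ceil_lt_add_one (by linarith : 0 ≤ K ^ g)).le
  have h3 : (2 : ℝ) ^ 3 ≤ K ^ 3 := by gcongr
  rw [pow_add]
  nlinarith

open Finset in
/-- The inverse theorem for Weyl sums over products of arithmetic progressions. -/
theorem exists_denominator_of_large_sum (D d : ℕ) : ∃ C : ℕ, ∀ {K : ℝ}, 2 ≤ K →
    ∀ {R : Fin D → ℝ}, (∀ i, K ^ C ≤ R i) → ∀ {q : Fin D → ℤ}, (∀ i, 0 < q i) →
    ∀ {E : Fin D → Finset ℤ}, (∀ i, IsStepProg (q i) (E i)) →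
    (∀ i, ∀ m ∈ E i, |(m : ℝ)| ≤ R i) → ∀ {c : (Fin D →₀ ℕ) → ℝ},
    (∏ i, R i) / K ≤ ‖∑ n ∈ Fintype.piFinset E, expE (polyVal d c n)‖ →
    ∃ Q : ℕ, 1 ≤ Q ∧ (Q : ℝ) ≤ K ^ C ∧ ∀ α : Fin D →₀ ℕ, 1 ≤ ∑ j, α j → ∑ j, α j ≤ d →
      ‖((Q * c α : ℝ) : UnitAddCircle)‖ * ∏ j, R j ^ α j ≤ K ^ C := by
  induction d with
  | zero =>
    refine ⟨0, ?_⟩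
    intro K hK R hR q hq E hqE hE c hsum
    exact ⟨1, le_rfl, by simp, fun α h1 h2 => by omega⟩
  | succ d ih =>
    obtain ⟨C, hC⟩ := ih
    obtain ⟨b, hb⟩ := exists_common_top_denominator D d
    set A := (finsuppAntidiag (univ : Finset (Fin D)) (d + 1)).card with hA
    -- K^g dominates the constants in the variation of the top part, so cells of relative size 1/J
    -- with J ≥ K^g suffice. K^e bounds the loss 4K(M(2J + 1))^D in passing to a sub-box.
    set g := 5 + A + (d + 1) + 2 * D + b with hg
    set e := 3 + (b + (g + 3)) * D with he
    refine ⟨e * C + b, ?_⟩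
    intro K hK R hR q hq E hqE hE c hsum
    have hK1 : 1 ≤ K := by linarith
    have hK0 : 0 < K := by linarith
    have hR1 : ∀ i, 1 ≤ R i := fun i => (one_le_pow₀ hK1).trans (hR i)
    have hR0 : ∀ i, 0 ≤ R i := fun i => by linarith [hR1 i]
    have hRα : ∀ α : Fin D →₀ ℕ, 0 ≤ ∏ j, R j ^ α j := fun α =>
      prod_nonneg fun j _ => pow_nonneg (hR0 j) _
    obtain ⟨M, hM1, hMb, hMα⟩ := hb hK
      (fun i => (pow_le_pow_right₀ hK1 (by omega)).trans (hR i)) hq hqE hE hsum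
    obtain ⟨J, hJ1, hJ2, hJ3⟩ := exists_nat_between_pow hK g
    have hJ0 : (0 : ℝ) < J := by exact_mod_cast hJ1
    set top : (Fin D → ℤ) → ℝ := fun n =>
      ∑ α ∈ finsuppAntidiag univ (d + 1), c α * ∏ j, (n j : ℝ) ^ α j with htop
    have hsum' : (∏ i, R i) / K
        ≤ ‖∑ n ∈ Fintype.piFinset E, expE (polyVal d c n) * expE (top n)‖ := by
      simpa only [polyVal_succ, expE_add] using hsum
    obtain ⟨q', hq', E', hqE', hEE', hsumE'⟩ := exists_subbox hK0 hR1 hq hqE hE hM1 hJ1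
      (fun n => (norm_expE _).le) (fun n => (norm_expE _).le) (by
        intro n hn n' hn' hdvd hclose
        rw [Fintype.mem_piFinset] at hn hn'
        refine (norm_expE_sub_expE_le _ _).trans ?_
        have h1 : ‖((top n - top n' : ℝ) : UnitAddCircle)‖ ≤ A * ((d + 1 : ℕ) * K ^ b / J) := by
          rw [htop, ← sum_sub_distrib]
          refine (torusNorm_sum_le _ _).trans ?_
          rw [hA, ← nsmul_eq_mul]
          refine sum_le_card_nsmul _ _ _ fun α hα => ?_
          refine (torusNorm_mul_mul_prod_le hM1 (c α) α (fun j => hE j _ (hn j))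
            (fun j => hE j _ (hn' j)) hclose hdvd).trans ?_
          rw [sum_eq_of_mem_finsuppAntidiag hα]
          gcongr
          exact hMα α hα
        have h2 : (2 * Real.pi * 2) * A * (d + 1 : ℕ) * 3 ^ D * K * K ^ b ≤ K ^ g := by
          have e1 : 2 * Real.pi * 2 ≤ K ^ 4 :=
            le_pow_of_le_two_pow hK 4 (by linarith [Real.pi_le_four])
          have e2 : (A : ℝ) ≤ K ^ A := le_pow_of_le_two_pow hK A (by exact_mod_cast Nat.lt_two_pow_self.le)
          have e3 : ((d + 1 : ℕ) : ℝ) ≤ K ^ (d + 1) :=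
            le_pow_of_le_two_pow hK _ (by exact_mod_cast Nat.lt_two_pow_self.le)
          have e4 := three_pow_le hK D
          calc _ ≤ K ^ 4 * K ^ A * K ^ (d + 1) * K ^ (2 * D) * K * K ^ b := by gcongr
            _ = _ := by rw [hg]; ring
        rw [le_div_iff₀ (by positivity)]
        calc _ ≤ 2 * Real.pi * (A * ((d + 1 : ℕ) * K ^ b / J)) * (2 * 3 ^ D * K) := by
              have := Real.pi_pos
              gcongr
          _ = ((2 * Real.pi * 2) * A * (d + 1 : ℕ) * 3 ^ D * K * K ^ b) / J := by ring
          _ ≤ 1 := by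
              rw [div_le_one hJ0]
              exact h2.trans hJ2) hsum'
    have hKe : 2 ≤ K ^ e := hK.trans (le_self_pow₀ hK1 (by omega))
    obtain ⟨Q, hQ1, hQ2, hQ3⟩ := hC hKe
      (fun i => by rw [← pow_mul]; exact (pow_le_pow_right₀ hK1 (by omega)).trans (hR i)) hq' hqE'
      (fun i m hm => hE i m (hEE' i hm)) (c := c) (le_trans (by
        have : 0 ≤ ∏ i, R i := prod_nonneg fun i _ => hR0 i
        gcongr
        have e1 : (4 : ℝ) ≤ K ^ 2 := le_pow_of_le_two_pow hK 2 (by norm_num)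
        calc 4 * K * (M * (2 * J + 1)) ^ D ≤ K ^ 2 * K * (K ^ b * K ^ (g + 3)) ^ D := by gcongr
          _ = K ^ e := by rw [he, ← pow_add K b, ← pow_mul]; ring) hsumE')
    rw [← pow_mul] at hQ2 hQ3
    refine ⟨Q * M, Nat.mul_pos hQ1 hM1, ?_, ?_⟩
    · push_cast
      rw [pow_add]
      gcongr
    · intro α hα1 hα2
      have hα0 := hRα α
      -- Lower coefficients are handled by Q and top ones by M; multiplying by the other factor
      -- costs only its size.
      rcases Nat.lt_or_ge (∑ j, α j) (d + 1) with hlt | hge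
      · calc _ = ‖((M * (Q * c α) : ℝ) : UnitAddCircle)‖ * ∏ j, R j ^ α j := by
              push_cast; ring_nf
          _ ≤ M * ‖((Q * c α : ℝ) : UnitAddCircle)‖ * ∏ j, R j ^ α j := by
              gcongr
              exact torusNorm_natCast_mul_le _ _
          _ = M * (‖((Q * c α : ℝ) : UnitAddCircle)‖ * ∏ j, R j ^ α j) := by ring
          _ ≤ K ^ b * K ^ (e * C) := by
              gcongr
              exact hQ3 α hα1 (by omega)
          _ = _ := by ring
      · have hmem : α ∈ finsuppAntidiag univ (d + 1) := by
          have := mem_finsuppAntidiag_univ α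
          rwa [le_antisymm hα2 hge] at this
        calc _ = ‖((Q * (M * c α) : ℝ) : UnitAddCircle)‖ * ∏ j, R j ^ α j := by
              push_cast; ring_nf
          _ ≤ Q * ‖((M * c α : ℝ) : UnitAddCircle)‖ * ∏ j, R j ^ α j := by
              gcongr
              exact torusNorm_natCast_mul_le _ _
          _ = Q * (‖((M * c α : ℝ) : UnitAddCircle)‖ * ∏ j, R j ^ α j) := by ring
          _ ≤ K ^ (e * C) * K ^ b := by
              gcongr
              exact hMα α hmem
          _ = _ := by ring

/-! ### Coefficient norm, amplitudes and box averages -/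

theorem sum_le_totalDegree {D : ℕ} {P : MvPolynomial (Fin D) ℝ} {α : Fin D →₀ ℕ}
    (h : α ∈ P.support) : ∑ j, α j ≤ P.totalDegree := by
  have := MvPolynomial.le_totalDegree h
  rwa [Finsupp.sum_fintype _ _ (fun _ => rfl)] at this

open Finset in
theorem evalInt_eq_polyVal {D d : ℕ} {P : MvPolynomial (Fin D) ℝ} (hP : P.totalDegree ≤ d)
    (n : Fin D → ℤ) : evalInt P n = polyVal d (fun α => P.coeff α) n := by
  unfold evalInt polyVal
  rw [MvPolynomial.eval_eq', ← sum_fiberwise_of_maps_to (s := P.support) (t := range (d + 1))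
    (g := fun α => ∑ j, α j)
    (fun α hα => mem_range.2 (Nat.lt_succ_of_le ((sum_le_totalDegree hα).trans hP)))]
  refine sum_congr rfl fun m _ => sum_subset ?_ ?_
  · intro α hα
    rw [← (mem_filter.1 hα).2]
    exact mem_finsuppAntidiag_univ α
  · intro α hα hα'
    have : P.coeff α = 0 := by
      by_contra h0
      exact hα' (mem_filter.2 ⟨MvPolynomial.mem_support_iff.2 h0, sum_eq_of_mem_finsuppAntidiag hα⟩)
    rw [this, zero_mul]

open Finset in
theorem card_support_le {D d : ℕ} {P : MvPolynomial (Fin D) ℝ} (hP : P.totalDegree ≤ d) :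
    P.support.card ≤
      ((range (d + 1)).biUnion fun m => finsuppAntidiag (univ : Finset (Fin D)) m).card := by
  refine card_le_card fun α hα => mem_biUnion.2 ⟨∑ j, α j, ?_, mem_finsuppAntidiag_univ α⟩
  exact mem_range.2 (Nat.lt_succ_of_le ((sum_le_totalDegree hα).trans hP))

theorem mul_evalInt {D : ℕ} (k : ℝ) (P : MvPolynomial (Fin D) ℝ) (n : Fin D → ℤ) :
    k * evalInt P n = evalInt (k • P) n := by
  unfold evalInt
  rw [MvPolynomial.smul_eval]

theorem bddBelow_coeffNorm {D : ℕ} (R : Fin D → ℝ) (P : MvPolynomial (Fin D) ℝ) :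
    BddBelow {x : ℝ | ∃ s : ℤ, CoeffNormCond R P s ∧ x = (2 : ℝ) ^ s} :=
  ⟨0, by rintro _ ⟨s, _, rfl⟩; positivity⟩

theorem nonempty_coeffNorm {D : ℕ} (R : Fin D → ℝ) (P : MvPolynomial (Fin D) ℝ) :
    {x : ℝ | ∃ s : ℤ, CoeffNormCond R P s ∧ x = (2 : ℝ) ^ s}.Nonempty := by
  obtain ⟨n, hn⟩ := pow_unbounded_of_one_lt (torusCoeffSum R 1 P) (one_lt_two : (1 : ℝ) < 2)
  have h1 : (2 : ℝ) ^ n ≤ 2 ^ (n + 1) := pow_le_pow_right₀ one_le_two (Nat.le_succ n)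
  have h2 : (2 : ℝ) ^ ((n : ℤ) + 1) = 2 ^ (n + 1) := by exact_mod_cast rfl
  refine ⟨_, (n : ℤ) + 1, Or.inl ⟨by omega, 1, le_rfl, ?_, ?_⟩, rfl⟩
  · rw [h2, Nat.cast_one]
    exact one_le_pow₀ one_le_two
  · rw [h2]
    exact hn.le.trans h1

/-- The factor 2 comes from rounding Y up to a power of two with positive exponent. -/
theorem coeffNorm_le_of_le {D : ℕ} {R : Fin D → ℝ} {P : MvPolynomial (Fin D) ℝ} {Q : ℕ} {Y : ℝ}
    (hQ1 : 1 ≤ Q) (hQY : (Q : ℝ) ≤ Y) (hY : torusCoeffSum R Q P ≤ Y) : coeffNorm R P ≤ 2 * Y := by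
  have hY1 : 1 ≤ Y := le_trans (by exact_mod_cast hQ1) hQY
  obtain ⟨n, hn1, hn2⟩ := exists_nat_pow_near hY1 (one_lt_two : (1 : ℝ) < 2)
  have h2 : (2 : ℝ) ^ ((n : ℤ) + 1) = 2 ^ (n + 1) := by exact_mod_cast rfl
  have h : CoeffNormCond R P ((n : ℤ) + 1) := by
    refine Or.inl ⟨by omega, Q, hQ1, ?_, ?_⟩ <;> rw [h2] <;> linarith
  calc coeffNorm R P ≤ (2 : ℝ) ^ ((n : ℤ) + 1) := csInf_le (bddBelow_coeffNorm R P) ⟨_, h, rfl⟩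
    _ = 2 * 2 ^ n := by rw [h2, pow_succ']
    _ ≤ 2 * Y := by gcongr

/-- The infimum need not be attained, so the bound is checked against every admissible exponent.
Some admissible exponent is nonpositive, hence the sum is at most 1, which settles the positive
exponents. -/
theorem torusCoeffSum_le_coeffNorm {D : ℕ} {R : Fin D → ℝ} {P : MvPolynomial (Fin D) ℝ}
    (h : coeffNorm R P ≤ 1) : torusCoeffSum R 1 P ≤ coeffNorm R P := by
  obtain ⟨_, ⟨s, hs, rfl⟩, hs2⟩ := exists_lt_of_csInf_lt (nonempty_coeffNorm R P)
    (show coeffNorm R P < 2 by linarith)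
  have hs1 : s < 1 := by
    by_contra hge
    have : (2 : ℝ) ^ (1 : ℤ) ≤ 2 ^ s := zpow_le_zpow_right₀ one_le_two (not_lt.1 hge)
    rw [zpow_one] at this
    linarith
  have hle : torusCoeffSum R 1 P ≤ 1 := by
    rcases hs with hs | hs
    · omega
    · exact hs.2.trans (zpow_le_one_of_nonpos₀ one_le_two hs.1)
  refine le_csInf (nonempty_coeffNorm R P) ?_
  rintro _ ⟨t, ht | ht, rfl⟩
  · exact hle.trans (one_le_zpow₀ one_le_two (by omega))
  · exact ht.2

theorem norm_le_one_of_amplitudeNorm {D : ℕ} {R : Fin D → ℝ} {φ : (Fin D → ℤ) → ℂ}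
    (h : amplitudeNorm R φ ≤ 1) (n : Fin D → ℤ) : ‖φ n‖ ≤ 1 := by
  have h1 : ‖φ n‖ₑ ≤ 1 := (le_iSup (fun n => ‖φ n‖ₑ) n).trans (le_self_add.trans h)
  rwa [← ofReal_norm, ENNReal.ofReal_le_one] at h1

theorem norm_sub_single_le {D : ℕ} {R : Fin D → ℝ} (hR : ∀ i, 1 ≤ R i) {φ : (Fin D → ℤ) → ℂ}
    (h : amplitudeNorm R φ ≤ 1) (j : Fin D) (n : Fin D → ℤ) :
    ‖φ n - φ (n - Pi.single j 1)‖ ≤ 1 / R j := by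
  have h0 : 0 < R j := by linarith [hR j]
  have h1 : ENNReal.ofReal (R j) * ‖φ n - φ (n - Pi.single j 1)‖ₑ ≤ 1 := by
    refine le_trans ?_ h
    refine le_trans ?_ le_add_self
    refine le_trans ?_ (Finset.single_le_sum
      (f := fun j => ENNReal.ofReal (R j) * ⨆ n, ‖φ n - φ (n - Pi.single j 1)‖ₑ)
      (fun _ _ => zero_le) (Finset.mem_univ j))
    gcongr
    exact le_iSup (fun n => ‖φ n - φ (n - Pi.single j 1)‖ₑ) n
  rw [← ofReal_norm, ← ENNReal.ofReal_mul h0.le, ENNReal.ofReal_le_one] at h1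
  rwa [le_div_iff₀ h0, mul_comm]

theorem norm_add_single_sub_le {D : ℕ} {φ : (Fin D → ℤ) → ℂ} {c : ℝ} {j : Fin D}
    (h : ∀ n, ‖φ n - φ (n - Pi.single j 1)‖ ≤ c) (n : Fin D → ℤ) (t : ℤ) :
    ‖φ (n + Pi.single j t) - φ n‖ ≤ |(t : ℝ)| * c := by
  have hnat : ∀ (t : ℕ) (n : Fin D → ℤ), ‖φ (n + Pi.single j (t : ℤ)) - φ n‖ ≤ t * c := by
    intro t n
    induction t with
    | zero => simp
    | succ t ih =>
      have h1 := h (n + Pi.single j ((t + 1 : ℕ) : ℤ))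
      have e : n + Pi.single j ((t + 1 : ℕ) : ℤ) - Pi.single j 1 = n + Pi.single j (t : ℤ) := by
        rw [add_sub_assoc, ← Pi.single_sub]
        simp
      rw [e] at h1
      have h2 := norm_sub_le_norm_sub_add_norm_sub (φ (n + Pi.single j ((t + 1 : ℕ) : ℤ)))
        (φ (n + Pi.single j (t : ℤ))) (φ n)
      rw [Nat.cast_succ (R := ℝ), add_mul, one_mul]
      linarith
  obtain ⟨m, rfl | rfl⟩ := Int.eq_nat_or_neg t
  · simpa using hnat m n
  · have := hnat m (n + Pi.single j (-(m : ℤ)))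
    rw [add_assoc, ← Pi.single_add, neg_add_cancel, Pi.single_zero, add_zero, norm_sub_rev] at this
    simpa using this

/-- Moving from n' to n one coordinate at a time, in unit steps, shows that the amplitude is
Lipschitz for the rescaled ℓ¹ distance. -/
theorem norm_sub_le_sum {D : ℕ} {R : Fin D → ℝ} (hR : ∀ i, 1 ≤ R i) {φ : (Fin D → ℤ) → ℂ}
    (h : amplitudeNorm R φ ≤ 1) (n n' : Fin D → ℤ) :
    ‖φ n - φ n'‖ ≤ ∑ j, |(n j : ℝ) - n' j| * (1 / R j) := by
  have key : ∀ s : Finset (Fin D), ‖φ (n' + ∑ j ∈ s, Pi.single j (n j - n' j)) - φ n'‖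
      ≤ ∑ j ∈ s, |(n j : ℝ) - n' j| * (1 / R j) := by
    intro s
    induction s using Finset.induction_on with
    | empty => simp
    | insert i s hi ih =>
      rw [Finset.sum_insert hi, Finset.sum_insert hi, add_comm (Pi.single i _), ← add_assoc]
      have h1 := norm_add_single_sub_le (norm_sub_single_le hR h i)
        (n' + ∑ j ∈ s, Pi.single j (n j - n' j)) (n i - n' i)
      push_cast at h1
      exact (norm_sub_le_norm_sub_add_norm_sub _ _ _).trans (add_le_add h1 ih)
  have e : n' + ∑ j, Pi.single j (n j - n' j) = n := by
    have := Finset.univ_sum_single (fun j => n j - n' j)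
    rw [this]
    ext j
    simp
  have := key Finset.univ
  rwa [e] at this

theorem norm_boxAverage_le {D : ℕ} {R : Fin D → ℝ} (hR : ∀ i, 1 ≤ R i) {A : Fin D → Finset ℤ}
    (hA : ∀ i, ∀ m ∈ A i, |(m : ℝ)| ≤ R i) {f : (Fin D → ℤ) → ℂ} {c : ℝ} (hc : 0 ≤ c)
    (hf : ∀ n ∈ Fintype.piFinset A, ‖f n‖ ≤ c) : ‖boxAverage R A f‖ ≤ 3 ^ D * c := by
  have hρ : 0 < ∏ i, R i := Finset.prod_pos fun i _ => by linarith [hR i]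
  unfold boxAverage
  rw [norm_mul, norm_inv, Complex.norm_real, Real.norm_of_nonneg hρ.le, ← div_eq_inv_mul,
    div_le_iff₀ hρ]
  calc _ ≤ (Fintype.piFinset A).card • c :=
        (norm_sum_le _ _).trans (Finset.sum_le_card_nsmul _ _ _ hf)
    _ = (Fintype.piFinset A).card * c := nsmul_eq_mul _ _
    _ ≤ (3 ^ D * ∏ i, R i) * c := by
      gcongr
      exact card_piFinset_le hR hA
    _ = _ := by ring

theorem torusNorm_evalInt_le {D : ℕ} {R : Fin D → ℝ} (P : MvPolynomial (Fin D) ℝ) {n : Fin D → ℤ}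
    (hn : ∀ i, |(n i : ℝ)| ≤ R i) : ‖(evalInt P n : UnitAddCircle)‖ ≤ torusCoeffSum R 1 P := by
  unfold evalInt torusCoeffSum
  rw [MvPolynomial.eval_eq']
  refine (torusNorm_sum_le _ _).trans (Finset.sum_le_sum fun α _ => ?_)
  have h1 := torusNorm_intCast_mul_le (∏ i, n i ^ α i) (P.coeff α)
  have h2 := abs_prod_pow_le hn α Finset.univ
  push_cast at h1
  rw [mul_comm, Nat.cast_one, one_mul]
  refine h1.trans ?_
  rw [mul_comm]
  gcongr

theorem norm_boxAverage_sub_le {D : ℕ} {R : Fin D → ℝ} (hR : ∀ i, 1 ≤ R i)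
    {A : Fin D → Finset ℤ} (hA : ∀ i, ∀ m ∈ A i, |(m : ℝ)| ≤ R i) {φ : (Fin D → ℤ) → ℂ}
    (hφ : ∀ n, ‖φ n‖ ≤ 1) {P : MvPolynomial (Fin D) ℝ} (hP : coeffNorm R P ≤ 1) :
    ‖boxAverage R A (fun n => expE (evalInt P n) * φ n) - boxAverage R A φ‖
      ≤ 3 ^ D * (2 * Real.pi * coeffNorm R P) := by
  have hN := torusCoeffSum_le_coeffNorm hP
  have e : boxAverage R A (fun n => expE (evalInt P n) * φ n) - boxAverage R A φ
      = boxAverage R A (fun n => (expE (evalInt P n) - 1) * φ n) := by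
    unfold boxAverage
    rw [← mul_sub, ← Finset.sum_sub_distrib]
    simp only [sub_mul, one_mul]
  have hpi := Real.pi_pos
  have hN0 : 0 ≤ coeffNorm R P := by
    refine le_csInf (nonempty_coeffNorm R P) ?_
    rintro _ ⟨s, _, rfl⟩
    positivity
  rw [e]
  refine norm_boxAverage_le hR hA (by positivity) fun n hn => ?_
  rw [norm_mul]
  have h1 := norm_expE_sub_one_le (evalInt P n)
  have h2 := torusNorm_evalInt_le P (fun i => hA i _ (Fintype.mem_piFinset.1 hn i))
  calc _ ≤ ‖expE (evalInt P n) - 1‖ * 1 := by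
        gcongr
        exact hφ n
    _ ≤ _ := by
        rw [mul_one]
        exact h1.trans (by gcongr; exact h2.trans hN)

/-! ### From the inverse theorem to the power saving -/

theorem inv_le_rpow_neg_of_le_pow {K Y : ℝ} {C : ℕ} (hC : C ≠ 0) (hK : 0 < K) (hY : 0 < Y)
    (h : Y ≤ K ^ C) : K⁻¹ ≤ Y ^ (-(C : ℝ)⁻¹) := by
  rw [Real.rpow_neg hY.le]
  have h1 : Y ^ (C : ℝ)⁻¹ ≤ (K ^ C) ^ (C : ℝ)⁻¹ := Real.rpow_le_rpow hY.le h (by positivity)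
  rw [Real.pow_rpow_inv_natCast hK.le hC] at h1
  exact inv_anti₀ (by positivity) h1

open Finset in
/-- A large average of `e(k P) φ` forces `P` to have small coefficient norm. -/
theorem exists_coeffNorm_le_of_large_boxAverage (D d : ℕ) : ∃ C : ℕ, C ≠ 0 ∧ ∀ {K : ℝ}, 2 ≤ K →
    ∀ {R : Fin D → ℝ}, (∀ i, K ^ C ≤ R i) → ∀ {P : MvPolynomial (Fin D) ℝ}, P.totalDegree ≤ d →
    ∀ {A : Fin D → Finset ℤ}, IsMultiArithProgIn R A → ∀ {φ : (Fin D → ℤ) → ℂ},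
    amplitudeNorm R φ ≤ 1 → ∀ {k : ℤ}, k ≠ 0 →
    K⁻¹ ≤ ‖boxAverage R A (fun n => expE ((k : ℝ) * evalInt P n) * φ n)‖ →
    coeffNorm R P ≤ |(k : ℝ)| * K ^ C := by
  obtain ⟨C, hC⟩ := exists_denominator_of_large_sum D d
  set B := ((range (d + 1)).biUnion fun m => finsuppAntidiag (univ : Finset (Fin D)) m).card with hB
  set g := 1 + D + 2 * D + 1 with hg
  set e := 3 + (g + 3) * D with he
  refine ⟨B + e * C + 1, by omega, ?_⟩
  intro K hK R hR P hP A hA φ hφ k hk havg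
  have hK1 : 1 ≤ K := by linarith
  have hK0 : 0 < K := by linarith
  have hR1 : ∀ i, 1 ≤ R i := fun i => (one_le_pow₀ hK1).trans (hR i)
  have hR0 : ∀ i, 0 < R i := fun i => by linarith [hR1 i]
  have hρ : 0 < ∏ i, R i := prod_pos fun i _ => hR0 i
  have hAR : ∀ i, ∀ m ∈ A i, |(m : ℝ)| ≤ R i := fun i => (hA i).2
  choose q hq hqA using fun i => (hA i).1.exists_isStepProg
  have hdeg : ((k : ℝ) • P).totalDegree ≤ d := (MvPolynomial.totalDegree_smul_le _ _).trans hP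
  have hsum : (∏ i, R i) / K ≤ ‖∑ n ∈ Fintype.piFinset A,
      expE (polyVal d (fun α => ((k : ℝ) • P).coeff α) n) * φ n‖ := by
    unfold boxAverage at havg
    rw [norm_mul, norm_inv, Complex.norm_real, Real.norm_of_nonneg hρ.le, ← div_eq_inv_mul,
      le_div_iff₀ hρ, ← div_eq_inv_mul] at havg
    simpa only [mul_evalInt, evalInt_eq_polyVal hdeg] using havg
  obtain ⟨J, hJ1, hJ2, hJ3⟩ := exists_nat_between_pow hK g
  have hJ0 : (0 : ℝ) < J := by exact_mod_cast hJ1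
  -- Modulus 1 suffices: closeness at scale R alone makes the amplitude almost constant.
  obtain ⟨q', hq', E', hqE', hEE', hsumE'⟩ := exists_subbox hK0 hR1 hq hqA hAR le_rfl hJ1
    (fun n => (norm_expE _).le) (norm_le_one_of_amplitudeNorm hφ) (by
      intro n _ n' _ _ hclose
      refine (norm_sub_le_sum hR1 hφ n n').trans ?_
      have h1 : ∑ j, |(n j : ℝ) - n' j| * (1 / R j) ≤ D * (1 / J) := by
        calc _ ≤ ∑ _j : Fin D, 1 / (J : ℝ) := by
              gcongr with j
              have := hR0 j
              calc _ ≤ R j / J * (1 / R j) := by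
                    gcongr
                    exact hclose j
                _ = _ := by field_simp
          _ = _ := by simp
      refine h1.trans ?_
      rw [mul_one_div, div_le_div_iff₀ hJ0 (by positivity), one_mul]
      refine le_trans ?_ hJ2
      have e2 : (D : ℝ) ≤ K ^ D := le_pow_of_le_two_pow hK _ (by exact_mod_cast Nat.lt_two_pow_self.le)
      have e3 := three_pow_le hK D
      calc (D : ℝ) * (2 * 3 ^ D * K) ≤ K ^ D * (K * K ^ (2 * D) * K) := by gcongr
        _ = K ^ g := by rw [hg]; ring) hsum
  have hKe : 2 ≤ K ^ e := hK.trans (le_self_pow₀ hK1 (by omega))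
  obtain ⟨Q, hQ1, hQ2, hQ3⟩ := hC hKe
    (fun i => by rw [← pow_mul]; exact (pow_le_pow_right₀ hK1 (by omega)).trans (hR i)) hq' hqE'
    (fun i m hm => hAR i m (hEE' i hm)) (le_trans (by
      gcongr
      have e1 : (4 : ℝ) ≤ K ^ 2 := le_pow_of_le_two_pow hK 2 (by norm_num)
      rw [Nat.cast_one, one_mul]
      calc 4 * K * (2 * J + 1) ^ D ≤ K ^ 2 * K * (K ^ (g + 3)) ^ D := by gcongr
        _ = K ^ e := by rw [he, ← pow_mul]; ring) hsumE')
  rw [← pow_mul] at hQ2 hQ3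
  have hk1 : 1 ≤ |(k : ℝ)| := by exact_mod_cast Int.one_le_abs hk
  have hkabs : ((k.natAbs : ℕ) : ℝ) = |(k : ℝ)| := by rw [Nat.cast_natAbs]; push_cast; rfl
  have hKp : 1 ≤ K ^ (e * C) := one_le_pow₀ hK1
  have hBK : (B : ℝ) ≤ K ^ B := le_pow_of_le_two_pow hK _ (by exact_mod_cast Nat.lt_two_pow_self.le)
  have hKB : 1 ≤ K ^ B := one_le_pow₀ hK1
  -- A denominator Q for kP gives the denominator Q|k| for P. The inverse theorem says nothing about
  -- the constant coefficient, but its weight is 1 and its torus norm at most 1/2.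
  have hterm : ∀ α ∈ P.support, ‖((((Q * k.natAbs : ℕ) : ℝ) * P.coeff α : ℝ) : UnitAddCircle)‖
      * ∏ i, R i ^ α i ≤ K ^ (e * C) := by
    intro α hα
    rcases Nat.eq_zero_or_pos (∑ j, α j) with h0 | h0
    · have hz : ∀ j, α j = 0 := by simpa using h0
      simp only [hz, pow_zero, prod_const_one, mul_one]
      exact (torusNorm_le_half _).trans (by linarith)
    · refine le_trans (le_of_eq ?_) (hQ3 α h0 ((sum_le_totalDegree hα).trans hP))
      congr 1
      rw [MvPolynomial.coeff_smul, smul_eq_mul, Nat.cast_mul, hkabs]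
      rcases abs_choice (k : ℝ) with h | h
      · rw [h, mul_assoc]
      · rw [h, mul_neg, neg_mul, AddCircle.coe_neg, norm_neg, mul_assoc]
  have hfin := coeffNorm_le_of_le (R := R) (P := P) (Q := Q * k.natAbs)
    (Y := |(k : ℝ)| * (K ^ B * K ^ (e * C))) (Nat.mul_pos hQ1 (Int.natAbs_pos.2 hk)) (by
      rw [Nat.cast_mul, hkabs, mul_comm]
      gcongr
      exact hQ2.trans (by nlinarith)) (by
      unfold torusCoeffSum
      calc _ ≤ P.support.card • K ^ (e * C) := sum_le_card_nsmul _ _ _ hterm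
        _ = P.support.card * K ^ (e * C) := nsmul_eq_mul _ _
        _ ≤ K ^ B * K ^ (e * C) := by
            gcongr
            exact (Nat.cast_le.2 (card_support_le hP)).trans hBK
        _ ≤ _ := le_mul_of_one_le_left (by positivity) hk1)
  calc _ ≤ _ := hfin
    _ ≤ K * (|(k : ℝ)| * (K ^ B * K ^ (e * C))) := by gcongr
    _ = _ := by ring

theorem theoremp (d D : ℕ) :
    ∃ θ : ℝ, 0 < θ ∧ ∃ C : ℝ, 0 < C ∧
      ∀ (R : Fin D → ℝ), (∀ i, 1 ≤ R i) →
      ∀ (P : MvPolynomial (Fin D) ℝ), P.totalDegree ≤ d →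
      ∀ (A : Fin D → Finset ℤ), IsMultiArithProgIn R A →
      ∀ (φ : (Fin D → ℤ) → ℂ), amplitudeNorm R φ ≤ 1 →
      ∀ k : ℤ,
        (k ≠ 0 → 2 ≤ coeffNorm R P →
          ‖boxAverage R A (fun n => expE ((k : ℝ) * evalInt P n) * φ n)‖
            ≤ C * ((|(k : ℝ)| / coeffNorm R P) ^ θ + ∑ i, R i ^ (-θ))) ∧
        (coeffNorm R ((k : ℝ) • P) ≤ 1 →
          ‖boxAverage R A (fun n => expE ((k : ℝ) * evalInt P n) * φ n) - boxAverage R A φ‖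
            ≤ C * coeffNorm R ((k : ℝ) • P)) := by
  obtain ⟨c, hc0, hc⟩ := exists_coeffNorm_le_of_large_boxAverage D d
  have hpi := Real.pi_pos
  refine ⟨(c : ℝ)⁻¹, by positivity, 3 ^ D * (2 * Real.pi), by positivity, ?_⟩
  intro R hR P hP A hA φ hφ k
  have hAR : ∀ i, ∀ m ∈ A i, |(m : ℝ)| ≤ R i := fun i => (hA i).2
  have hφ1 := norm_le_one_of_amplitudeNorm hφ
  have hR0 : ∀ i, 0 < R i := fun i => by linarith [hR i]
  constructor
  · intro hk hN
    set X := ‖boxAverage R A (fun n => expE ((k : ℝ) * evalInt P n) * φ n)‖ with hX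
    have hX3 : X ≤ 3 ^ D * 1 := norm_boxAverage_le hR hAR zero_le_one fun n _ => by
      rw [norm_mul, norm_expE, one_mul]
      exact hφ1 n
    have hN0 : 0 < coeffNorm R P := by linarith
    have hk0 : 0 < |(k : ℝ)| := abs_pos.2 (by exact_mod_cast hk)
    have hterm : ∀ i, 0 ≤ R i ^ (-(c : ℝ)⁻¹) := fun i => Real.rpow_nonneg (hR0 i).le _
    rcases eq_or_lt_of_le (show 0 ≤ X from norm_nonneg _) with h0 | h0
    · rw [← h0]
      have := Finset.sum_nonneg fun i (_ : i ∈ Finset.univ) => hterm i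
      positivity
    have h3 : (1 : ℝ) ≤ 3 ^ D := one_le_pow₀ (by norm_num)
    -- The trivial bound X ≤ 3^D makes K ≥ 2, while 1/K ≤ X meets the hypothesis of the inverse
    -- theorem. It remains to bound 1/K, with θ the reciprocal of the exponent c.
    set K := 2 * 3 ^ D / X with hK
    have hK2 : 2 ≤ K := by
      rw [hK, le_div_iff₀ h0]
      linarith
    have hXK : X = 2 * 3 ^ D * K⁻¹ := by
      rw [hK]
      field_simp
    have hKX : K⁻¹ ≤ X := by
      have : 0 < K⁻¹ := by positivity
      rw [hXK]
      nlinarith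
    have hmain : K⁻¹ ≤ (|(k : ℝ)| / coeffNorm R P) ^ (c : ℝ)⁻¹ + ∑ i, R i ^ (-(c : ℝ)⁻¹) := by
      -- Either the inverse theorem applies and bounds the norm of P by |k| K^c, or some side
      -- satisfies R_i < K^c and its own term R_i^{-θ} already exceeds 1/K.
      by_cases hbig : ∀ i, K ^ c ≤ R i
      · have h1 := hc hK2 hbig hP hA hφ hk hKX
        have h2 := inv_le_rpow_neg_of_le_pow hc0 (show 0 < K by positivity)
          (show 0 < coeffNorm R P / |(k : ℝ)| by positivity) (by rwa [div_le_iff₀' hk0])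
        rw [Real.rpow_neg (by positivity), ← Real.inv_rpow (by positivity), inv_div (coeffNorm R P)] at h2
        have := Finset.sum_nonneg fun i (_ : i ∈ Finset.univ) => hterm i
        linarith
      · push Not at hbig
        obtain ⟨i, hi⟩ := hbig
        have h2 := inv_le_rpow_neg_of_le_pow hc0 (show 0 < K by positivity) (hR0 i) hi.le
        have h4 := Finset.single_le_sum (fun i _ => hterm i) (Finset.mem_univ i)
        have : 0 ≤ (|(k : ℝ)| / coeffNorm R P) ^ (c : ℝ)⁻¹ := by positivity
        linarith
    rw [hXK]
    calc 2 * 3 ^ D * K⁻¹ = 3 ^ D * (2 * 1) * K⁻¹ := by ring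
      _ ≤ _ := by
        gcongr
        linarith [Real.pi_gt_three]
  · intro hN
    simp only [mul_evalInt]
    refine (norm_boxAverage_sub_le hR hAR hφ1 hN).trans (le_of_eq ?_)
    ring
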